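/- Let $(\mathscr A,E)$ be a tracial $W^*$-probability space, that is, a von Neumann algebra $\mathscr A$ of operators on a complex Hilbert space together with a unital, weakly continuous, positive, faithful and tracial linear functional $E$ on $\mathscr A$. The law of a self-adjoint $x\in\mathscr A$ is the unique Borel probability measure $\mu$ on $\mathbb R$ with $E(x^m)=\int s^m\,d\mu(s)$ for all integers $m\ge 0$. Let $S=(S_t)_{t\ge 0}$ be a free Brownian motion on $(\mathscr A,E)$: there are von Neumann subalgebras $(\mathscr A_t)_{t\ge 0}$ of $\mathscr A$, increasing in $t$, such that each $S_t$ is self-adjoint, belongs to $\mathscr A_t$ and has the centered semicircular law $S(0,t)$ of variance $t$, and, for $0\le u<t$, $S_t-S_u$ is freely independent of $\mathscr A_u$ and has law $S(0,t-u)$ (where $S(0,0)=\delta_0$). For $q\ge 1$ and real-valued $f\in L^2(\mathbb R_+^q)$, let $I_q(f)$ denote the Wigner integral of $f$ with respect to $S$: for $f=\mathbf 1_{(a_1,b_1)}\otimes\cdots\otimes\mathbf 1_{(a_q,b_q)}$ with pairwise disjoint intervals, $I_q(f)=(S_{b_1}-S_{a_1})\cdots(S_{b_q}-S_{a_q})$;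 this is extended linearly to finite real linear combinations of such functions, and then to all $f\in L^2(\mathbb R_+^q)$ by $L^2(\mathbb R_+^q)$–$L^2(\mathscr A,E)$ continuity, where $\|x\|_{L^2(\mathscr A,E)}=E(x^*x)^{1/2}$. The tetilla law is the law of $\frac1{\sqrt2}(xy+yx)$, where $x,y$ are freely independent random variables (in some tracial $W^*$-probability space), each with the semicircular law $S(0,1)$. Let $q\ge 3$ be an integer and let $f\in L^2(\mathbb R_+^q)$ be real-valued with $\|f\|_{L^2(\mathbb R_+^q)}=1$ and $f(t_1,\dots,t_q)=f(t_q,\dots,t_1)$ for almost all $t_1,\dots,t_q\in\mathbb R_+$. Then $I_q(f)$, which is a well-defined self-adjoint element of $\mathscr A$, is not distributed according to the tetilla law. -/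

import Mathlib

open MeasureTheory Filter Topology
open scoped NNReal ENNReal ComplexOrder

/-! ### Non-commutative probability -/

/-- `μ` is the law of the random variable `x` of the non-commutative probability space `(A, φ)`:
a Borel probability measure on `ℝ` such that `φ (x ^ m) = ∫ s ^ m dμ(s)` for all `m ≥ 0`. -/
def IsLaw {A : Type*} [Ring A] [Algebra ℂ A] (φ : A →ₗ[ℂ] ℂ) (x : A) (μ : Measure ℝ) : Prop :=
  IsProbabilityMeasure μ ∧
    ∀ m : ℕ, Integrable (fun s : ℝ => s ^ m) μ ∧ φ (x ^ m) = ((∫ s, s ^ m ∂μ : ℝ) : ℂ)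

/-- Free independence of a family of unital subalgebras: `φ (x₀ x₁ ⋯ xₘ) = 0` whenever the `xⱼ` are
centered and consecutive ones are taken from different members of the family. -/
def FreelyIndependent {A : Type*} [Ring A] [Algebra ℂ A] (φ : A →ₗ[ℂ] ℂ) {ι : Type*}
    (B : ι → Subalgebra ℂ A) : Prop :=
  ∀ (m : ℕ) (i : Fin (m + 1) → ι) (x : Fin (m + 1) → A),
    (∀ j : Fin m, i j.castSucc ≠ i j.succ) → (∀ j, x j ∈ B (i j)) → (∀ j, φ (x j) = 0) →
      φ (List.ofFn x).prod = 0

/-- The centered semicircular distribution `S(0, t)` of variance `t`, with density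
`(2πt)⁻¹ √(4t - u²)` on `(-2√t, 2√t)`; for `t = 0` it is the Dirac mass at `0`. -/
noncomputable def semicircular (t : ℝ≥0) : Measure ℝ :=
  if t = 0 then Measure.dirac 0
  else volume.withDensity fun u => ENNReal.ofReal
    ((Set.Ioo (-(2 * √(t : ℝ))) (2 * √(t : ℝ))).indicator
      (fun u => 1 / (2 * Real.pi * t) * √(4 * t - u ^ 2)) u)

/-- A tracial `W*`-probability space `(𝒜, E)`, where `𝒜` is a von Neumann algebra of operators on
the Hilbert space `H`. -/
structure WStarProbabilitySpace (H : Type*) [NormedAddCommGroup H] [InnerProductSpace ℂ H]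
    [CompleteSpace H] where
  /-- the von Neumann algebra -/
  algebra : VonNeumannAlgebra H
  /-- the expectation -/
  E : algebra.toStarSubalgebra →ₗ[ℂ] ℂ
  map_one : E 1 = 1
  /-- Weak continuity on bounded sets, that is, normality; it is implied by continuity of `E` on
  the whole of `𝒜` in the weak operator topology. -/
  weakly_continuous : ∀ (r : ℝ) (l : Filter algebra.toStarSubalgebra)
    (a : algebra.toStarSubalgebra), (∀ᶠ x in l, ‖x‖ ≤ r) →
    (∀ u v : H, Tendsto (fun x : algebra.toStarSubalgebra => inner ℂ u ((x : H →L[ℂ] H) v)) l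
      (𝓝 (inner ℂ u ((a : H →L[ℂ] H) v)))) →
    Tendsto E l (𝓝 (E a))
  positive : ∀ x, 0 ≤ E (x * star x)
  faithful : ∀ x, E (x * star x) = 0 → x = 0
  tracial : ∀ x y, E (x * y) = E (y * x)

namespace WStarProbabilitySpace

variable {H : Type*} [NormedAddCommGroup H] [InnerProductSpace ℂ H] [CompleteSpace H]

/-- The operators of the von Neumann algebra, as a type. -/
abbrev Elem (P : WStarProbabilitySpace H) : Type _ := P.algebra.toStarSubalgebra

/-- The norm of `L²(𝒜, E)`, `‖x‖₂ = E(x* x)^{1/2}`. -/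
noncomputable def l2Norm (P : WStarProbabilitySpace H) (x : P.Elem) : ℝ :=
  √(P.E (star x * x)).re

/-- A von Neumann algebra `N` on `H` (in the uses below, contained in `𝒜`) as a unital subalgebra
of `𝒜`. -/
noncomputable def subalgebraOf (P : WStarProbabilitySpace H) (N : VonNeumannAlgebra H) :
    Subalgebra ℂ P.Elem :=
  N.toStarSubalgebra.toSubalgebra.comap P.algebra.toStarSubalgebra.subtype.toAlgHom

/-- Free independence of a random variable `x` from a von Neumann subalgebra `N` of `𝒜`. -/
def FreeFrom (P : WStarProbabilitySpace H) (x : P.Elem) (N : VonNeumannAlgebra H) : Prop :=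
  FreelyIndependent P.E ![Algebra.adjoin ℂ {x}, P.subalgebraOf N]

/-- Free independence of two random variables. -/
def Free (P : WStarProbabilitySpace H) (x y : P.Elem) : Prop :=
  FreelyIndependent P.E ![Algebra.adjoin ℂ {x}, Algebra.adjoin ℂ {y}]

end WStarProbabilitySpace

universe u v

/-- `μ` is the tetilla law: the law of `(xy + yx) / √2`, where `x` and `y` are free semicircular
random variables of variance one in some tracial `W*`-probability space. -/
def IsTetillaLaw (μ : Measure ℝ) : Prop :=
  ∃ (K : Type v) (_ : NormedAddCommGroup K) (_ : InnerProductSpace ℂ K) (_ : CompleteSpace K)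
    (Q : WStarProbabilitySpace K) (x y : Q.Elem),
    IsSelfAdjoint x ∧ IsSelfAdjoint y ∧ IsLaw Q.E x (semicircular 1) ∧
    IsLaw Q.E y (semicircular 1) ∧ Q.Free x y ∧
    IsLaw Q.E (((√2 : ℝ) : ℂ)⁻¹ • (x * y + y * x)) μ

/-! ### Free Brownian motion and Wigner integrals -/

section Wigner

variable {H : Type*} [NormedAddCommGroup H] [InnerProductSpace ℂ H] [CompleteSpace H]

/-- A free Brownian motion on `(𝒜, E)`. -/
structure FreeBrownianMotion (P : WStarProbabilitySpace H) where
  /-- the filtration -/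
  filtration : ℝ≥0 → VonNeumannAlgebra H
  filtration_le : ∀ t, filtration t ≤ P.algebra
  filtration_mono : Monotone filtration
  /-- the process -/
  S : ℝ≥0 → P.Elem
  selfAdjoint : ∀ t, IsSelfAdjoint (S t)
  adapted : ∀ t, (S t : H →L[ℂ] H) ∈ filtration t
  law : ∀ t, IsLaw P.E (S t) (semicircular t)
  free_increment : ∀ u t, u < t → P.FreeFrom (S t - S u) (filtration u)
  law_increment : ∀ u t, u < t → IsLaw P.E (S t - S u) (semicircular (t - u))

/-- Lebesgue measure on `ℝ₊^q`, as a measure on `ℝ^q`. -/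
noncomputable abbrev orthantMeasure (q : ℕ) : Measure (Fin q → ℝ) :=
  Measure.pi fun _ => volume.restrict (Set.Ici 0)

/-- A product of `q` pairwise disjoint intervals `(a₁, b₁) × ⋯ × (a_q, b_q)` in `ℝ₊^q`. -/
structure OffDiagonalBox (q : ℕ) where
  /-- left end points -/
  a : Fin q → ℝ≥0
  /-- right end points -/
  b : Fin q → ℝ≥0
  lt : ∀ i, a i < b i
  disjoint : ∀ i j, i ≠ j → Disjoint (Set.Ioo (a i) (b i)) (Set.Ioo (a j) (b j))

/-- The function `t ↦ 1_{(a₁, b₁)}(t₁) ⋯ 1_{(a_q, b_q)}(t_q)`. -/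
noncomputable def OffDiagonalBox.indicator {q : ℕ} (B : OffDiagonalBox q) (t : Fin q → ℝ) : ℝ :=
  ∏ i, (Set.Ioo (B.a i : ℝ) (B.b i : ℝ)).indicator 1 (t i)

/-- The ordered product `(S_{b₁} - S_{a₁}) ⋯ (S_{b_q} - S_{a_q})`. -/
noncomputable def OffDiagonalBox.integral {q : ℕ} (B : OffDiagonalBox q)
    {P : WStarProbabilitySpace H} (W : FreeBrownianMotion P) : P.Elem :=
  (List.ofFn fun i => W.S (B.b i) - W.S (B.a i)).prod

/-- The simple function vanishing on diagonals given by a finite real linear combination. -/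
noncomputable def simpleFunction {q : ℕ} (s : OffDiagonalBox q →₀ ℝ) (t : Fin q → ℝ) : ℝ :=
  s.sum fun B c => c * B.indicator t

/-- The Wigner integral of a simple function vanishing on diagonals. -/
noncomputable def simpleIntegral {q : ℕ} {P : WStarProbabilitySpace H} (W : FreeBrownianMotion P)
    (s : OffDiagonalBox q →₀ ℝ) : P.Elem :=
  s.sum fun B c => (c : ℂ) • B.integral W

/-- `X = I_q(f)`: there are simple functions vanishing on diagonals which converge to `f` in
`L²(ℝ₊^q)` and whose Wigner integrals converge to `X` in `L²(𝒜, E)`. -/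
def IsWignerIntegral {q : ℕ} {P : WStarProbabilitySpace H} (W : FreeBrownianMotion P)
    (f : Lp ℝ 2 (orthantMeasure q)) (X : P.Elem) : Prop :=
  ∃ s : ℕ → OffDiagonalBox q →₀ ℝ,
    Tendsto (fun n => eLpNorm (fun t => simpleFunction (s n) t - f t) 2 (orthantMeasure q))
      atTop (𝓝 0) ∧
    Tendsto (fun n => P.l2Norm (simpleIntegral W (s n) - X)) atTop (𝓝 0)

end Wigner

/-! ### Sums over words -/

section Words

variable {ι : Type*} [Fintype ι]

/-- The words of length `n` over a finite alphabet. -/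
def words (ι : Type*) [Fintype ι] (n : ℕ) : Finset (List ι) :=
  (Finset.univ : Finset (Fin n → ι)).map ⟨List.ofFn, List.ofFn_injective⟩

@[simp]
theorem mem_words {n : ℕ} {w : List ι} : w ∈ words ι n ↔ w.length = n := by
  constructor
  · intro h
    obtain ⟨g, -, rfl⟩ := Finset.mem_map.1 h
    simp
  · rintro rfl
    exact Finset.mem_map.2 ⟨w.get, Finset.mem_univ _, List.ofFn_get w⟩

theorem sum_words_add {M : Type*} [AddCommMonoid M] (m n : ℕ) (g : List ι → M) :
    ∑ w ∈ words ι (m + n), g w = ∑ u ∈ words ι m, ∑ v ∈ words ι n, g (u ++ v) := by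
  rw [← Finset.sum_product']
  refine Finset.sum_nbij' (fun w => (w.take m, w.drop m)) (fun p => p.1 ++ p.2) ?_ ?_ ?_ ?_ ?_
  · intro w hw
    simp only [mem_words, Finset.mem_product, List.length_take, List.length_drop] at hw ⊢
    omega
  · intro p hp
    simp only [mem_words, Finset.mem_product, List.length_append] at hp ⊢
    omega
  · intro w _
    simp
  · rintro ⟨u, v⟩ hp
    simp only [mem_words, Finset.mem_product] at hp
    simp [← hp.1]
  · intro w _
    simp

theorem sum_words_reverse {M : Type*} [AddCommMonoid M] (n : ℕ) (g : List ι → M) :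
    ∑ w ∈ words ι n, g w.reverse = ∑ w ∈ words ι n, g w :=
  Finset.sum_nbij' List.reverse List.reverse (by simp) (by simp) (by simp) (by simp) (by simp)

@[simp]
theorem sum_words_zero {M : Type*} [AddCommMonoid M] (g : List ι → M) :
    ∑ w ∈ words ι 0, g w = g [] := by
  have : words ι 0 = {[]} := by ext; simp
  simp [this]

theorem sum_words_one {M : Type*} [AddCommMonoid M] (g : List ι → M) :
    ∑ w ∈ words ι 1, g w = ∑ i, g [i] := by
  refine Finset.sum_bij' (fun w hw => w.head (by rintro rfl; simp at hw)) (fun i _ => [i])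
    (by simp) (by simp) ?_ (by simp) ?_
  · intro w hw
    rw [mem_words, List.length_eq_one_iff] at hw
    obtain ⟨i, rfl⟩ := hw
    rfl
  · intro w hw
    rw [mem_words, List.length_eq_one_iff] at hw
    obtain ⟨i, rfl⟩ := hw
    rfl

theorem sum_words_succ {M : Type*} [AddCommMonoid M] (n : ℕ) (g : List ι → M) :
    ∑ w ∈ words ι (n + 1), g w = ∑ i, ∑ w ∈ words ι n, g (i :: w) := by
  rw [add_comm, sum_words_add, sum_words_one]
  rfl

end Words

/-! ### Wick words in a free semicircular system -/

section Wick

variable {A : Type*} [Ring A] [Algebra ℂ A] {ι : Type*} [DecidableEq ι]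

/-- The Wick product `:x_{i₁} ⋯ x_{iₙ}:`, which corresponds to `e_{i₁} ⊗ ⋯ ⊗ e_{iₙ}` in the full
Fock space. -/
def wick (x : ι → A) : List ι → A
  | [] => 1
  | [i] => x i
  | i :: j :: w => x i * wick x (j :: w) - if i = j then wick x w else 0

/-- `x` is a free family of semicircular random variables of variance one. -/
def IsSemicircularSystem (φ : A →ₗ[ℂ] ℂ) (x : ι → A) : Prop :=
  φ 1 = 1 ∧ ∀ w : List ι, w ≠ [] → φ (wick x w) = 0

/-- Creation plus annihilation by the letter `i`, on words. -/
noncomputable def letterActWord (i : ι) : List ι → (List ι →₀ ℝ)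
  | [] => Finsupp.single [i] 1
  | j :: w => Finsupp.single (i :: j :: w) 1 + if i = j then Finsupp.single w 1 else 0

/-- Creation plus annihilation by the letter `i`. -/
noncomputable def letterAct (i : ι) : (List ι →₀ ℝ) →ₗ[ℝ] (List ι →₀ ℝ) :=
  Finsupp.linearCombination ℝ (letterActWord i)

theorem letterAct_apply_nil (i : ι) (v : List ι →₀ ℝ) : letterAct i v [] = v [i] := by
  induction v using Finsupp.induction_linear with
  | zero => simp
  | add u v hu hv => simp [hu, hv]
  | single w c =>
    rcases w with _ | ⟨j, _ | ⟨k, w⟩⟩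
    · simp [letterAct, letterActWord]
    · by_cases h : i = j
      · simp [letterAct, letterActWord, h]
      · simp [letterAct, letterActWord, h]
    · by_cases h : i = j <;> simp [letterAct, letterActWord, h]

theorem letterAct_apply_cons (i j : ι) (w : List ι) (v : List ι →₀ ℝ) :
    letterAct i v (j :: w) = v (i :: j :: w) + if i = j then v w else 0 := by
  induction v using Finsupp.induction_linear with
  | zero => simp
  | add u v hu hv => simp only [map_add, Finsupp.add_apply, hu, hv]; split_ifs <;> ring
  | single u c =>
    rcases u with _ | ⟨k, u⟩
    · simp only [letterAct, letterActWord, Finsupp.linearCombination_single, Finsupp.smul_single,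
        Finsupp.single_apply]
      by_cases h : i = j <;> simp [h, eq_comm]
    · simp only [letterAct, letterActWord, Finsupp.linearCombination_single, smul_add,
        Finsupp.smul_single, Finsupp.add_apply, smul_ite, smul_zero]
      rw [add_comm]
      by_cases hik : i = k <;> by_cases hij : i = j <;>
        simp [Finsupp.single_apply, hik, hij] <;> grind

/-- The element of the algebra with a given Fock space vector. -/
noncomputable def wickSum (x : ι → A) : (List ι →₀ ℝ) →ₗ[ℝ] A :=
  Finsupp.linearCombination ℝ (wick x)

@[simp]
theorem wickSum_single (x : ι → A) (w : List ι) (c : ℝ) :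
    wickSum x (Finsupp.single w c) = c • wick x w := by
  simp [wickSum]

omit [Algebra ℂ A] in
theorem mul_wick (x : ι → A) (i j : ι) (w : List ι) :
    x i * wick x (j :: w) = wick x (i :: j :: w) + if i = j then wick x w else 0 := by
  rw [wick]; simp

theorem mul_wickSum (x : ι → A) (i : ι) (v : List ι →₀ ℝ) :
    x i * wickSum x v = wickSum x (letterAct i v) := by
  induction v using Finsupp.induction_linear with
  | zero => simp
  | add u v hu hv => simp only [map_add, mul_add, hu, hv]
  | single w c =>
    rcases w with _ | ⟨j, w⟩
    · simp [letterAct, letterActWord, wick]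
    · rw [wickSum_single, mul_smul_comm, mul_wick]
      by_cases h : i = j <;> simp [letterAct, letterActWord, h]

variable [StarRing A] [StarModule ℂ A]

omit [StarModule ℂ A] in
theorem IsSemicircularSystem.map_star_wick_mul_wick {φ : A →ₗ[ℂ] ℂ} {x : ι → A}
    (hx : IsSemicircularSystem φ x) (hsa : ∀ i, IsSelfAdjoint (x i)) :
    ∀ u v : List ι, φ (star (wick x u) * wick x v) = if u = v then 1 else 0
  | [], v => by
    by_cases hv : v = []
    · simp [wick, hv, hx.1]
    · simp [wick, hx.2 v hv, Ne.symm hv]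
  | [i], [] => by
    have h := hx.2 [i] (by simp)
    rw [wick] at h
    simp [wick, (hsa i).star_eq, h]
  | [i], j :: v => by
    rw [show wick x [i] = x i from rfl, (hsa i).star_eq, mul_wick, map_add,
      hx.2 (i :: j :: v) (by simp), zero_add]
    by_cases h : i = j
    · by_cases hv : v = []
      · simp [h, hv, wick, hx.1]
      · simp [h, hx.2 v hv, Ne.symm hv]
    · simp [h]
  | i :: k :: u, [] => by
    have h1 := map_star_wick_mul_wick hx hsa (k :: u) [i]
    have h2 := map_star_wick_mul_wick hx hsa u []
    simp only [wick, mul_one] at h1 h2 ⊢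
    rw [star_sub, star_mul, (hsa i).star_eq, map_sub, h1]
    by_cases h : i = k
    · simp [h, h2]
    · have : ¬ k = i := fun e => h e.symm
      simp [h, this]
  | i :: k :: u, j :: v => by
    have h1 := map_star_wick_mul_wick hx hsa (k :: u) (i :: j :: v)
    have h2 := map_star_wick_mul_wick hx hsa (k :: u) v
    have h3 := map_star_wick_mul_wick hx hsa u (j :: v)
    rw [show wick x (i :: k :: u) = x i * wick x (k :: u) - if i = k then wick x u else 0 from rfl,
      star_sub, star_mul, (hsa i).star_eq, sub_mul, mul_assoc, mul_wick, map_sub, mul_add, map_add,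
      h1]
    by_cases hij : i = j <;> by_cases hik : i = k <;>
      simp_all [eq_comm]

theorem IsSemicircularSystem.map_star_wickSum_mul {φ : A →ₗ[ℂ] ℂ} {x : ι → A}
    (hx : IsSemicircularSystem φ x) (hsa : ∀ i, IsSelfAdjoint (x i)) (u v : List ι →₀ ℝ) :
    φ (star (wickSum x u) * wickSum x v) = ((u.sum fun w c => c * v w : ℝ) : ℂ) := by
  induction u using Finsupp.induction_linear with
  | zero => simp
  | add u u' hu hu' =>
    rw [map_add, star_add, add_mul, map_add, hu, hu', Finsupp.sum_add_index' (by simp)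
      (by intros; ring)]
    push_cast; rfl
  | single w c =>
    induction v using Finsupp.induction_linear with
    | zero => simp
    | add v v' hv hv' =>
      rw [map_add, mul_add, map_add, hv, hv']
      simp [mul_add]
    | single w' c' =>
      rw [wickSum_single, wickSum_single, star_smul, smul_mul_smul_comm,
        LinearMap.map_smul_of_tower, hx.map_star_wick_mul_wick hsa]
      by_cases h : w = w'
      · simp [h]
      · have : ¬ w' = w := fun e => h e.symm
        simp [h, Finsupp.single_apply, this]

end Wick

section FockOperator

variable {ι : Type*} [DecidableEq ι]

/-- The action of a word on the full Fock space. -/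
noncomputable def wordAct : List ι → (List ι →₀ ℝ) →ₗ[ℝ] (List ι →₀ ℝ)
  | [] => LinearMap.id
  | i :: u => letterAct i ∘ₗ wordAct u

theorem wordAct_apply_cons_of_isChain (v : List ι →₀ ℝ) : ∀ (u : List ι) (i : ι) (w : List ι),
    (i :: u).IsChain (· ≠ ·) → wordAct u v (i :: w) = v (u.reverse ++ i :: w)
  | [], i, w, _ => rfl
  | k :: u, i, w, h => by
    rw [List.isChain_cons_cons] at h
    have := wordAct_apply_cons_of_isChain v u k (i :: w) h.2
    simp only [wordAct, LinearMap.comp_apply, letterAct_apply_cons, this, if_neg (Ne.symm h.1)]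
    simp

theorem wordAct_apply (v : List ι →₀ ℝ) : ∀ (u w : List ι), u.IsChain (· ≠ ·) →
    wordAct u v w = ∑ j ∈ Finset.range (u.length + 1),
      if j ≤ w.length ∧ u.take j = w.take j then v ((u.drop j).reverse ++ w.drop j) else 0
  | [], w, _ => by simp [wordAct]
  | i :: u, [], h => by
    have := wordAct_apply_cons_of_isChain v u i [] h
    rw [Finset.sum_range_succ', Finset.sum_eq_zero (by simp)]
    simp [wordAct, letterAct_apply_nil, this]
  | i :: u, k :: w, h => by
    have h1 := wordAct_apply_cons_of_isChain v u i (k :: w) h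
    have h2 := wordAct_apply v u w (List.IsChain.tail h)
    rw [Finset.sum_range_succ']
    simp only [wordAct, LinearMap.comp_apply, letterAct_apply_cons, h1, h2]
    rw [add_comm]
    congr 1
    · by_cases hik : i = k <;> simp [hik]
    · simp

variable [Fintype ι]

/-- The action of `∑ f u x_u` on the full Fock space. -/
noncomputable def fockOp (q : ℕ) (f : List ι → ℝ) : (List ι →₀ ℝ) →ₗ[ℝ] (List ι →₀ ℝ) :=
  ∑ u ∈ words ι q, f u • wordAct u

theorem fockOp_apply {q : ℕ} {f : List ι → ℝ} (hf : ∀ u, f u ≠ 0 → u.IsChain (· ≠ ·))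
    (v : List ι →₀ ℝ) (w : List ι) :
    fockOp q f v w = ∑ j ∈ Finset.range (q + 1), if j ≤ w.length then
      ∑ a ∈ words ι (q - j), f (w.take j ++ a) * v (a.reverse ++ w.drop j) else 0 := by
  have h1 : ∀ u ∈ words ι q, f u * wordAct u v w = ∑ j ∈ Finset.range (q + 1), f u *
      if j ≤ w.length ∧ u.take j = w.take j then v ((u.drop j).reverse ++ w.drop j) else 0 := by
    intro u hu
    by_cases h0 : f u = 0
    · simp [h0]
    · rw [wordAct_apply v u w (hf u h0), Finset.mul_sum, mem_words.1 hu]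
  simp only [fockOp, LinearMap.sum_apply, LinearMap.smul_apply, Finsupp.finsetSum_apply,
    Finsupp.smul_apply, smul_eq_mul]
  rw [Finset.sum_congr rfl h1, Finset.sum_comm]
  refine Finset.sum_congr rfl fun j hj => ?_
  obtain ⟨r, rfl⟩ := Nat.exists_eq_add_of_le (Finset.mem_range_succ_iff.1 hj)
  rw [sum_words_add, Nat.add_sub_cancel_left]
  by_cases hjw : j ≤ w.length
  · rw [if_pos hjw, Finset.sum_eq_single (w.take j)]
    · refine Finset.sum_congr rfl fun a _ => ?_
      rw [List.take_left' (by simp [hjw]), List.drop_left' (by simp [hjw])]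
      simp [hjw]
    · intro p hp hne
      refine Finset.sum_eq_zero fun a _ => ?_
      rw [List.take_left' (mem_words.1 hp), if_neg (fun h => hne h.2), mul_zero]
    · intro h
      simp [hjw] at h
  · simp [hjw]

variable {A : Type*} [Ring A] [Algebra ℂ A]

/-- The element `∑ f u x_u` of the algebra. -/
noncomputable def wordSum (x : ι → A) (q : ℕ) (f : List ι → ℝ) : A :=
  ∑ u ∈ words ι q, f u • (u.map x).prod

omit [Fintype ι] in
theorem map_prod_mul_wickSum (x : ι → A) (v : List ι →₀ ℝ) : ∀ u : List ι,
    (u.map x).prod * wickSum x v = wickSum x (wordAct u v)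
  | [] => by simp [wordAct]
  | i :: u => by
    rw [List.map_cons, List.prod_cons, mul_assoc, map_prod_mul_wickSum x v u, mul_wickSum]
    rfl

theorem wordSum_mul_wickSum (x : ι → A) (q : ℕ) (f : List ι → ℝ) (v : List ι →₀ ℝ) :
    wordSum x q f * wickSum x v = wickSum x (fockOp q f v) := by
  simp only [wordSum, fockOp, Finset.sum_mul, LinearMap.sum_apply, map_sum, smul_mul_assoc,
    map_prod_mul_wickSum, LinearMap.smul_apply, map_smul]

theorem wordSum_pow (x : ι → A) (q : ℕ) (f : List ι → ℝ) (m : ℕ) :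
    wordSum x q f ^ m = wickSum x ((fockOp q f ^ m) (Finsupp.single [] 1)) := by
  induction m with
  | zero => simp [wick]
  | succ m ih => rw [pow_succ', ih, wordSum_mul_wickSum, pow_succ']; rfl

variable [StarRing A] [StarModule ℂ A]

omit [DecidableEq ι] in
theorem star_wordSum {x : ι → A} (hsa : ∀ i, IsSelfAdjoint (x i)) (q : ℕ) (f : List ι → ℝ) :
    star (wordSum x q f) = wordSum x q fun u => f u.reverse := by
  have h : ∀ u : List ι, star (u.map x).prod = (u.reverse.map x).prod := by
    intro u
    induction u with
    | nil => simp
    | cons i u ih => simp [ih, (hsa i).star_eq]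
  rw [wordSum, wordSum, ← sum_words_reverse]
  simp only [star_sum, star_smul, star_trivial, h, List.reverse_reverse]

end FockOperator

/-! ### Norms of Fock space vectors -/

section Norm

variable {ι : Type*} [DecidableEq ι] [Fintype ι]

/-- The squared norm of the component of order `n`. -/
def normSqOrder (n : ℕ) (v : List ι → ℝ) : ℝ := ∑ w ∈ words ι n, v w ^ 2

omit [DecidableEq ι] in
theorem normSqOrder_nonneg (n : ℕ) (v : List ι → ℝ) : 0 ≤ normSqOrder n v :=
  Finset.sum_nonneg fun _ _ => sq_nonneg _

omit [DecidableEq ι] in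
theorem sum_mul_eq_sum_range (u v : List ι →₀ ℝ) (N : ℕ) (hN : ∀ w, u w ≠ 0 → w.length < N) :
    (u.sum fun w c => c * v w) = ∑ n ∈ Finset.range N, ∑ w ∈ words ι n, u w * v w := by
  rw [Finset.sum_sigma', Finsupp.sum]
  refine Finset.sum_bij_ne_zero (fun w _ _ => ⟨w.length, w⟩) ?_ ?_ ?_ ?_
  · intro w hw _
    simp [hN w (Finsupp.mem_support_iff.1 hw)]
  · intro w _ _ w' _ _ h
    simpa using (Sigma.mk.inj_iff.1 h).2
  · rintro ⟨n, w⟩ hw h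
    simp only [Finset.mem_sigma, mem_words] at hw
    obtain ⟨_, rfl⟩ := hw
    exact ⟨w, by simpa using left_ne_zero_of_mul h, h, rfl⟩
  · intro w _ _
    rfl

omit [DecidableEq ι] [Fintype ι] in
theorem exists_length_lt (u : List ι →₀ ℝ) : ∃ N, ∀ w, u w ≠ 0 → w.length < N := by
  refine ⟨u.support.sup List.length + 1, fun w hw => Nat.lt_succ_of_le ?_⟩
  exact Finset.le_sup (f := List.length) (Finsupp.mem_support_iff.2 hw)

/-- The squared norm of a Fock space vector. -/
noncomputable def fockNormSq (u : List ι →₀ ℝ) : ℝ := u.sum fun _ c => c ^ 2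

omit [DecidableEq ι] in
theorem fockNormSq_eq (u : List ι →₀ ℝ) (N : ℕ) (hN : ∀ w, u w ≠ 0 → w.length < N) :
    fockNormSq u = ∑ n ∈ Finset.range N, normSqOrder n u := by
  rw [fockNormSq, show (u.sum fun _ c => c ^ 2) = u.sum fun w c => c * u w from
    Finset.sum_congr rfl fun w _ => sq _, sum_mul_eq_sum_range u u N hN]
  simp only [normSqOrder, sq]

omit [DecidableEq ι] in
theorem sum_normSqOrder_le (u : List ι →₀ ℝ) (s : Finset ℕ) :
    ∑ n ∈ s, normSqOrder n u ≤ fockNormSq u := by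
  obtain ⟨N, hN⟩ := exists_length_lt u
  rw [fockNormSq_eq u (max N (s.sup id + 1)) fun w hw => lt_max_of_lt_left (hN w hw)]
  refine Finset.sum_le_sum_of_subset_of_nonneg (fun n hn => ?_) fun n _ _ => normSqOrder_nonneg n _
  exact Finset.mem_range.2 (lt_max_of_lt_right (Nat.lt_succ_of_le (Finset.le_sup (f := id) hn)))

/-- The part of `fockOp q f` which creates `j` letters. -/
def fockPart (q j : ℕ) (f v : List ι → ℝ) (w : List ι) : ℝ :=
  if j ≤ w.length then
    ∑ a ∈ words ι (q - j), f (w.take j ++ a) * v (a.reverse ++ w.drop j) else 0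

omit [DecidableEq ι] in
theorem normSqOrder_fockPart_le {q j : ℕ} (hj : j ≤ q) (f v : List ι → ℝ) (n : ℕ) :
    normSqOrder (j + n) (fockPart q j f v) ≤ normSqOrder q f * normSqOrder (q - j + n) v := by
  rw [normSqOrder, sum_words_add]
  have hf : normSqOrder q f = ∑ p ∈ words ι j, ∑ a ∈ words ι (q - j), f (p ++ a) ^ 2 := by
    rw [← sum_words_add j (q - j) (fun w => f w ^ 2), Nat.add_sub_cancel' hj]; rfl
  have hv : normSqOrder (q - j + n) v =
      ∑ w ∈ words ι n, ∑ a ∈ words ι (q - j), v (a.reverse ++ w) ^ 2 := by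
    rw [normSqOrder, sum_words_add, ← sum_words_reverse, Finset.sum_comm]
  rw [hf, hv, Finset.sum_mul_sum]
  refine Finset.sum_le_sum fun p hp => Finset.sum_le_sum fun w hw => ?_
  rw [mem_words] at hp
  rw [fockPart, if_pos (by simp [hp]), List.take_left' hp, List.drop_left' hp]
  exact Finset.sum_mul_sq_le_sq_mul_sq _ _ _

theorem fockNormSq_fockOp_le {q : ℕ} {f : List ι → ℝ} (hf : ∀ u, f u ≠ 0 → u.IsChain (· ≠ ·))
    (v : List ι →₀ ℝ) :
    fockNormSq (fockOp q f v) ≤ (q + 1) ^ 2 * normSqOrder q f * fockNormSq v := by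
  obtain ⟨N, hN⟩ := exists_length_lt (fockOp q f v)
  rw [fockNormSq_eq _ N hN]
  have key : ∀ j ∈ Finset.range (q + 1), ∑ n ∈ Finset.range N, normSqOrder n (fockPart q j f v) ≤
      normSqOrder q f * fockNormSq v := by
    intro j hj
    have hj' := Finset.mem_range_succ_iff.1 hj
    calc _ ≤ ∑ n ∈ Finset.range (j + N), normSqOrder n (fockPart q j f v) :=
          Finset.sum_le_sum_of_subset_of_nonneg (Finset.range_mono (Nat.le_add_left _ _))
            fun n _ _ => normSqOrder_nonneg n _
      _ = ∑ n ∈ Finset.range N, normSqOrder (j + n) (fockPart q j f v) := by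
          rw [Finset.sum_range_add, Finset.sum_eq_zero, zero_add]
          intro n hn
          refine Finset.sum_eq_zero fun w hw => ?_
          rw [mem_words] at hw
          rw [fockPart, if_neg (by have := Finset.mem_range.1 hn; omega), sq, zero_mul]
      _ ≤ ∑ n ∈ Finset.range N, normSqOrder q f * normSqOrder (q - j + n) v :=
          Finset.sum_le_sum fun n _ => normSqOrder_fockPart_le hj' f v n
      _ ≤ normSqOrder q f * fockNormSq v := by
          rw [← Finset.mul_sum]
          refine mul_le_mul_of_nonneg_left ?_ (normSqOrder_nonneg _ _)
          rw [← Finset.sum_image (f := fun n => normSqOrder n v) (g := fun n => q - j + n)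
            (fun a _ b _ h => Nat.add_left_cancel h)]
          exact sum_normSqOrder_le _ _
  have h2 : ∀ n, normSqOrder n (fockOp q f v) ≤
      (q + 1) * ∑ j ∈ Finset.range (q + 1), normSqOrder n (fockPart q j f v) := by
    intro n
    simp only [normSqOrder]
    rw [Finset.sum_comm, Finset.mul_sum]
    refine Finset.sum_le_sum fun w _ => ?_
    rw [fockOp_apply hf]
    have := sq_sum_le_card_mul_sum_sq (s := Finset.range (q + 1))
      (f := fun j => fockPart q j f v w)
    simpa [fockPart] using this
  calc _ ≤ ∑ n ∈ Finset.range N,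
        (q + 1) * ∑ j ∈ Finset.range (q + 1), normSqOrder n (fockPart q j f v) :=
        Finset.sum_le_sum fun n _ => h2 n
    _ = (q + 1) * ∑ j ∈ Finset.range (q + 1), ∑ n ∈ Finset.range N,
          normSqOrder n (fockPart q j f v) := by rw [← Finset.mul_sum, Finset.sum_comm]
    _ ≤ (q + 1) * ∑ j ∈ Finset.range (q + 1), normSqOrder q f * fockNormSq v := by
        gcongr with j hj
        exact key j hj
    _ = _ := by simp; ring

variable {A : Type*} [Ring A] [Algebra ℂ A] [StarRing A] [StarModule ℂ A]

theorem map_star_pow_mul_pow_wordSum {φ : A →ₗ[ℂ] ℂ} {x : ι → A} (hx : IsSemicircularSystem φ x)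
    (hsa : ∀ i, IsSelfAdjoint (x i)) (q : ℕ) (f : List ι → ℝ) (m : ℕ) :
    φ (star (wordSum x q f ^ m) * wordSum x q f ^ m) =
      (fockNormSq ((fockOp q f ^ m) (Finsupp.single [] 1)) : ℝ) := by
  rw [wordSum_pow, hx.map_star_wickSum_mul hsa, fockNormSq]
  congr 1
  exact Finset.sum_congr rfl fun w _ => (sq _).symm

theorem fockNormSq_pow_le {q : ℕ} {f : List ι → ℝ} (hf : ∀ u, f u ≠ 0 → u.IsChain (· ≠ ·))
    (m : ℕ) : fockNormSq ((fockOp q f ^ m) (Finsupp.single [] 1)) ≤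
      ((q + 1) ^ 2 * normSqOrder q f) ^ m := by
  induction m with
  | zero => simp [fockNormSq]
  | succ m ih =>
    rw [pow_succ', pow_succ']
    exact (fockNormSq_fockOp_le hf _).trans (mul_le_mul_of_nonneg_left ih
      (mul_nonneg (by positivity) (normSqOrder_nonneg _ _)))

end Norm

/-! ### Contractions and the sixth moment -/

section Contraction

variable {ι : Type*} [Fintype ι]

/-- The contraction `(f ⌢^r f) ⌢^{k-r} f` for `r ≤ k ≤ q`. -/
def tripleContraction (q k r : ℕ) (f : List ι → ℝ) (w : List ι) : ℝ :=
  ∑ a ∈ words ι r, ∑ b ∈ words ι (k - r), f (w.take (q - r) ++ a) *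
    f (a.reverse ++ ((w.drop (q - r)).take (q - k) ++ b)) *
    f (b.reverse ++ (w.drop (q - r)).drop (q - k))

/-- Three copies of `f` contracted in a triangle, with `t` contractions between two of them,
`r` and `q - r` between the others. -/
def triangleContraction (q t r : ℕ) (f : List ι → ℝ) (x : List ι) : ℝ :=
  ∑ p ∈ words ι (q - r), ∑ a ∈ words ι r, ∑ m ∈ words ι t,
    f (p ++ a) * f (p ++ (m ++ (x.take (r - t)).reverse)) * f (a.reverse ++ (m ++ x.drop (r - t)))

theorem sum_words_add_five (k l m n o : ℕ) (g : List ι → ℝ) :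
    ∑ w ∈ words ι (k + (l + (m + (n + o)))), g w = ∑ p ∈ words ι k, ∑ a ∈ words ι l,
      ∑ b ∈ words ι m, ∑ c ∈ words ι n, ∑ d ∈ words ι o, g (p ++ (a ++ (b ++ (c ++ d)))) := by
  rw [sum_words_add]
  refine Finset.sum_congr rfl fun p _ => ?_
  rw [sum_words_add]
  refine Finset.sum_congr rfl fun a _ => ?_
  rw [sum_words_add]
  refine Finset.sum_congr rfl fun b _ => ?_
  rw [sum_words_add]

theorem sum_hexagon {α : Type*} (P M Y N B A₁ B₁ A₂ B₂ : Finset α) (F₁ : α → α → ℝ)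
    (F₂ F₃ G₁ G₂ : α → α → α → α → ℝ) (G₃ : α → α → ℝ) :
    ∑ p ∈ P, ∑ m ∈ M, ∑ y ∈ Y, ∑ n ∈ N, ∑ b ∈ B,
      (∑ a₁ ∈ A₁, ∑ b₁ ∈ B₁, F₁ p a₁ * F₂ a₁ m y b₁ * F₃ b₁ y n b) *
      (∑ a₂ ∈ A₂, ∑ b₂ ∈ B₂, G₁ p m y a₂ * G₂ a₂ y n b₂ * G₃ b₂ b) =
    ∑ a₂ ∈ A₂, ∑ y ∈ Y, ∑ b₁ ∈ B₁,
      (∑ p ∈ P, ∑ a₁ ∈ A₁, ∑ m ∈ M, F₁ p a₁ * G₁ p m y a₂ * F₂ a₁ m y b₁) *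
      (∑ b₂ ∈ B₂, ∑ b ∈ B, ∑ n ∈ N, G₃ b₂ b * G₂ a₂ y n b₂ * F₃ b₁ y n b) := by
  simp only [Finset.sum_mul, Finset.mul_sum]
  simp only [← Finset.sum_product']
  refine Finset.sum_nbij' (fun (p, m, y, n, b, a₂, b₂, a₁, b₁) => (a₂, y, b₁, b₂, b, n, p, a₁, m))
    (fun (a₂, y, b₁, b₂, b, n, p, a₁, m) => (p, m, y, n, b, a₂, b₂, a₁, b₁)) ?_ ?_ ?_ ?_ ?_
  · rintro ⟨p, m, y, n, b, a₂, b₂, a₁, b₁⟩ h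
    simp only [Finset.mem_product] at h ⊢
    tauto
  · rintro ⟨a₂, y, b₁, b₂, b, n, p, a₁, m⟩ h
    simp only [Finset.mem_product] at h ⊢
    tauto
  · exact fun _ _ => rfl
  · exact fun _ _ => rfl
  · exact fun _ _ => by ring

theorem sum_tripleContraction_mul_of_le {q k r r' : ℕ} {f : List ι → ℝ}
    (hrev : ∀ w, f w.reverse = f w) (hr : r' < r) (hrk : r ≤ k) (hk : k < q)
    (hd : r - r' ≤ q - k) :
    ∑ w ∈ words ι (3 * q - 2 * k), tripleContraction q k r f w * tripleContraction q k r' f w =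
    ∑ x ∈ words ι (q - 2 * (r - r')), triangleContraction q (r - r') r f x *
      triangleContraction q (r - r') (q - (k - r')) f x := by
  obtain ⟨d, rfl⟩ := Nat.exists_eq_add_of_le hr.le
  obtain ⟨s, rfl⟩ := Nat.exists_eq_add_of_le hrk
  obtain ⟨y, rfl⟩ : ∃ y, q = r' + d + s + d + y := ⟨q - (r' + d + s + d), by omega⟩
  rw [show 3 * (r' + d + s + d + y) - 2 * (r' + d + s) = s + d + y + (d + (y + (d + (r' + d + y))))
    by omega, show r' + d - r' = d by omega,
    show r' + d + s + d + y - 2 * d = r' + (y + s) by omega]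
  have h1 : ∀ p ∈ words ι (s + d + y), ∀ m ∈ words ι d, ∀ z ∈ words ι y, ∀ n ∈ words ι d,
      ∀ b ∈ words ι (r' + d + y),
      tripleContraction (r' + d + s + d + y) (r' + d + s) (r' + d) f
          (p ++ (m ++ (z ++ (n ++ b)))) *
        tripleContraction (r' + d + s + d + y) (r' + d + s) r' f (p ++ (m ++ (z ++ (n ++ b)))) =
      (∑ a₁ ∈ words ι (r' + d), ∑ b₁ ∈ words ι s, f (p ++ a₁) *
        f (a₁.reverse ++ (m ++ (z ++ b₁))) * f (b₁.reverse ++ (n ++ b))) *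
      (∑ a₂ ∈ words ι r', ∑ b₂ ∈ words ι (d + s), f (p ++ (m ++ a₂)) *
        f (a₂.reverse ++ (z ++ (n ++ b₂))) * f (b₂.reverse ++ b)) := by
    intro p hp m hm z hz n hn b hb
    rw [mem_words] at hp hm hz hn hb
    rw [tripleContraction, tripleContraction,
      show r' + d + s + d + y - (r' + d) = p.length by omega,
      show r' + d + s + d + y - (r' + d + s) = (m ++ z).length by simp; omega,
      show r' + d + s + d + y - r' = (p ++ m).length by simp; omega,
      show r' + d + s - (r' + d) = s by omega, show r' + d + s - r' = d + s by omega,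
      List.take_left, List.drop_left, ← List.append_assoc m z, List.take_left, List.drop_left,
      List.append_assoc m z, ← List.append_assoc p m, List.take_left, List.drop_left,
      ← List.append_assoc z n, List.take_left' (by simp; omega), List.drop_left' (by simp; omega)]
    simp only [List.append_assoc]
  have h2 : ∀ a₂ ∈ words ι r', ∀ z ∈ words ι y, ∀ b₁ ∈ words ι s,
      triangleContraction (r' + d + s + d + y) d (r' + d) f (a₂.reverse ++ (z ++ b₁)) *
      triangleContraction (r' + d + s + d + y) d (r' + d + s + d + y - (r' + d + s - r')) f
        (a₂.reverse ++ (z ++ b₁)) =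
      (∑ p ∈ words ι (s + d + y), ∑ a₁ ∈ words ι (r' + d), ∑ m ∈ words ι d, f (p ++ a₁) *
        f (p ++ (m ++ a₂)) * f (a₁.reverse ++ (m ++ (z ++ b₁)))) *
      (∑ b₂ ∈ words ι (d + s), ∑ b ∈ words ι (r' + d + y), ∑ n ∈ words ι d,
        f (b₂.reverse ++ b) * f (a₂.reverse ++ (z ++ (n ++ b₂))) *
        f (b₁.reverse ++ (n ++ b))) := by
    intro a₂ ha z hz b₁ hb
    rw [mem_words] at ha hz hb
    rw [triangleContraction, triangleContraction,
      show r' + d + s + d + y - (r' + d + s - r') = r' + d + y by omega,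
      show r' + d + s + d + y - (r' + d) = s + d + y by omega,
      show r' + d + s + d + y - (r' + d + y) = d + s by omega,
      List.take_left' (by simp; omega), List.drop_left' (by simp; omega), List.reverse_reverse,
      ← List.append_assoc, List.take_left' (by simp; omega), List.drop_left' (by simp; omega)]
    congr 1
    rw [← sum_words_reverse (d + s)]
    refine Finset.sum_congr rfl fun b₂ _ => Finset.sum_congr rfl fun b _ => ?_
    rw [← sum_words_reverse d]
    refine Finset.sum_congr rfl fun n _ => ?_
    rw [← hrev (a₂.reverse ++ _), ← hrev (b₁.reverse ++ _)]
    simp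
  have h3 : ∀ g : List ι → ℝ, ∑ x ∈ words ι (r' + (y + s)), g x = ∑ a ∈ words ι r',
      ∑ z ∈ words ι y, ∑ b ∈ words ι s, g (a.reverse ++ (z ++ b)) := by
    intro g
    rw [sum_words_add, ← sum_words_reverse r']
    refine Finset.sum_congr rfl fun a _ => ?_
    rw [sum_words_add]
  rw [h3, sum_words_add_five]
  have h4 := sum_hexagon (words ι (s + d + y)) (words ι (d)) (words ι (y)) (words ι (d)) (words ι (r' + d + y)) (words ι (r' + d)) (words ι (s)) (words ι (r')) (words ι (d + s)) (fun p a => f (p ++ a))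
    (fun a m z b => f (a.reverse ++ (m ++ (z ++ b)))) (fun b z n b' => f (b.reverse ++ (n ++ b')))
    (fun p m z a => f (p ++ (m ++ a))) (fun a z n b => f (a.reverse ++ (z ++ (n ++ b))))
    (fun b b' => f (b.reverse ++ b'))
  refine Eq.trans ?_ (h4.trans ?_)
  · refine Finset.sum_congr rfl fun p hp => ?_
    refine Finset.sum_congr rfl fun m hm => ?_
    refine Finset.sum_congr rfl fun z hz => ?_
    refine Finset.sum_congr rfl fun n hn => ?_
    refine Finset.sum_congr rfl fun b hb => ?_
    exact h1 p hp m hm z hz n hn b hb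
  · refine Finset.sum_congr rfl fun a ha => ?_
    refine Finset.sum_congr rfl fun z hz => ?_
    refine Finset.sum_congr rfl fun b hb => ?_
    exact (h2 a ha z hz b hb).symm

theorem sum_tripleContraction_mul_of_lt {q k r r' : ℕ} {f : List ι → ℝ}
    (hrev : ∀ w, f w.reverse = f w) (hr : r' < r) (hrk : r ≤ k) (hk : k < q)
    (hd : q - k < r - r') :
    ∑ w ∈ words ι (3 * q - 2 * k), tripleContraction q k r f w * tripleContraction q k r' f w =
    ∑ x ∈ words ι (q - 2 * (q - k)), triangleContraction q (q - k) r f x *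
      triangleContraction q (q - k) (q - (k - r')) f x := by
  obtain ⟨t, rfl⟩ := Nat.exists_eq_add_of_le hk.le
  obtain ⟨s, rfl⟩ := Nat.exists_eq_add_of_le hrk
  obtain ⟨y, rfl⟩ : ∃ y, r = r' + t + y := ⟨r - (r' + t), by omega⟩
  rw [show 3 * (r' + t + y + s + t) - 2 * (r' + t + y + s) = s + t + (t + (y + (t + (r' + t))))
    by omega, show r' + t + y + s + t - 2 * (r' + t + y + s + t - (r' + t + y + s)) =
      r' + (y + s) by omega, show r' + t + y + s + t - (r' + t + y + s) = t by omega]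
  have h1 : ∀ p ∈ words ι (s + t), ∀ m ∈ words ι t, ∀ z ∈ words ι y, ∀ n ∈ words ι t,
      ∀ b ∈ words ι (r' + t),
      tripleContraction (r' + t + y + s + t) (r' + t + y + s) (r' + t + y) f
          (p ++ (m ++ (z ++ (n ++ b)))) *
        tripleContraction (r' + t + y + s + t) (r' + t + y + s) r' f
          (p ++ (m ++ (z ++ (n ++ b)))) =
      (∑ a₁ ∈ words ι (r' + t + y), ∑ b₁ ∈ words ι s, f (p ++ a₁) *
        f (a₁.reverse ++ (m ++ b₁)) * f (b₁.reverse ++ (z ++ (n ++ b)))) *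
      (∑ a₂ ∈ words ι r', ∑ b₂ ∈ words ι (t + y + s), f (p ++ (m ++ (z ++ a₂))) *
        f (a₂.reverse ++ (n ++ b₂)) * f (b₂.reverse ++ b)) := by
    intro p hp m hm z hz n hn b hb
    rw [mem_words] at hp hm hz hn hb
    rw [tripleContraction, tripleContraction,
      show r' + t + y + s + t - (r' + t + y) = p.length by omega,
      show r' + t + y + s + t - (r' + t + y + s) = m.length by omega,
      show r' + t + y + s + t - r' = (p ++ (m ++ z)).length by simp; omega,
      show r' + t + y + s - (r' + t + y) = s by omega, show r' + t + y + s - r' = t + y + s by omega,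
      List.take_left, List.drop_left, List.take_left, List.drop_left,
      ← List.append_assoc m z, ← List.append_assoc p (m ++ z) (n ++ b), List.take_left,
      List.drop_left, List.take_left' (by omega), List.drop_left' (by omega)]
    simp only [List.append_assoc]
  have h2 : ∀ a₂ ∈ words ι r', ∀ z ∈ words ι y, ∀ b₁ ∈ words ι s,
      triangleContraction (r' + t + y + s + t) t (r' + t + y) f
        (a₂.reverse ++ (z.reverse ++ b₁)) *
      triangleContraction (r' + t + y + s + t) t (r' + t + y + s + t - (r' + t + y + s - r')) f
        (a₂.reverse ++ (z.reverse ++ b₁)) =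
      (∑ p ∈ words ι (s + t), ∑ a₁ ∈ words ι (r' + t + y), ∑ m ∈ words ι t, f (p ++ a₁) *
        f (p ++ (m ++ (z ++ a₂))) * f (a₁.reverse ++ (m ++ b₁))) *
      (∑ b₂ ∈ words ι (t + y + s), ∑ b ∈ words ι (r' + t), ∑ n ∈ words ι t,
        f (b₂.reverse ++ b) * f (a₂.reverse ++ (n ++ b₂)) *
        f (b₁.reverse ++ (z ++ (n ++ b)))) := by
    intro a₂ ha z hz b₁ hb
    rw [mem_words] at ha hz hb
    rw [triangleContraction, triangleContraction,
      show r' + t + y + s + t - (r' + t + y + s - r') = r' + t by omega,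
      show r' + t + y + s + t - (r' + t + y) = s + t by omega,
      show r' + t + y + s + t - (r' + t) = t + y + s by omega,
      show r' + t + y - t = (a₂.reverse ++ z.reverse).length by simp; omega,
      show r' + t - t = a₂.reverse.length by simp; omega,
      List.take_left, List.drop_left,
      ← List.append_assoc, List.take_left, List.drop_left]
    congr 1
    · simp
    rw [← sum_words_reverse (t + y + s)]
    refine Finset.sum_congr rfl fun b₂ _ => Finset.sum_congr rfl fun b _ => ?_
    rw [← sum_words_reverse t]
    refine Finset.sum_congr rfl fun n _ => ?_
    rw [← hrev (a₂.reverse ++ _), ← hrev (b₁.reverse ++ _)]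
    simp
  have h3 : ∀ g : List ι → ℝ, ∑ x ∈ words ι (r' + (y + s)), g x = ∑ a ∈ words ι r',
      ∑ z ∈ words ι y, ∑ b ∈ words ι s, g (a.reverse ++ (z.reverse ++ b)) := by
    intro g
    rw [sum_words_add, ← sum_words_reverse r']
    refine Finset.sum_congr rfl fun a _ => ?_
    rw [sum_words_add, ← sum_words_reverse y]
  rw [h3, sum_words_add_five]
  have h4 := sum_hexagon (words ι (s + t)) (words ι (t)) (words ι (y)) (words ι (t)) (words ι (r' + t)) (words ι (r' + t + y)) (words ι (s)) (words ι (r')) (words ι (t + y + s)) (fun p a => f (p ++ a))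
    (fun a m z b => f (a.reverse ++ (m ++ b))) (fun b z n b' => f (b.reverse ++ (z ++ (n ++ b'))))
    (fun p m z a => f (p ++ (m ++ (z ++ a)))) (fun a z n b => f (a.reverse ++ (n ++ b)))
    (fun b b' => f (b.reverse ++ b'))
  refine Eq.trans ?_ (h4.trans ?_)
  · refine Finset.sum_congr rfl fun p hp => ?_
    refine Finset.sum_congr rfl fun m hm => ?_
    refine Finset.sum_congr rfl fun z hz => ?_
    refine Finset.sum_congr rfl fun n hn => ?_
    refine Finset.sum_congr rfl fun b hb => ?_
    exact h1 p hp m hm z hz n hn b hb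
  · refine Finset.sum_congr rfl fun a ha => ?_
    refine Finset.sum_congr rfl fun z hz => ?_
    refine Finset.sum_congr rfl fun b hb => ?_
    exact (h2 a ha z hz b hb).symm

end Contraction

section SixthMoment

variable {ι : Type*} [Fintype ι]

theorem sum_range_sq_eq (n : ℕ) (a : ℕ → ℝ) : (∑ r ∈ Finset.range n, a r) ^ 2 =
    ∑ r ∈ Finset.range n, a r ^ 2 +
      2 * ∑ r ∈ Finset.range n, ∑ r' ∈ Finset.range r, a r * a r' := by
  induction n with
  | zero => simp
  | succ n ih =>
    rw [Finset.sum_range_succ, Finset.sum_range_succ, Finset.sum_range_succ, add_sq, ih,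
      ← Finset.mul_sum]
    ring

theorem sum_offDiag_reindex (q : ℕ) (P N : ℕ → ℕ → ℕ → ℝ)
    (h₁ : ∀ k r r', r' < r → r ≤ k → k < q → r - r' ≤ q - k →
      P k r r' = N (r - r') r (q - (k - r')))
    (h₂ : ∀ k r r', r' < r → r ≤ k → k < q → q - k < r - r' →
      P k r r' = N (q - k) r (q - (k - r'))) :
    ∑ k ∈ Finset.range q, ∑ r ∈ Finset.range (k + 1), ∑ r' ∈ Finset.range r, P k r r' =
    ∑ t ∈ Finset.Icc 1 q, ∑ r ∈ Finset.Icc t (q - t), ∑ ρ ∈ Finset.Icc t (q - t), N t r ρ := by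
  simp only [Finset.sum_sigma']
  refine Finset.sum_nbij'
    (fun y => ⟨min (y.2.1 - y.2.2) (q - y.1), y.2.1, q - (y.1 - y.2.2)⟩)
    (fun y => if y.2.1 ≤ y.2.2 then ⟨(y.2.1 - y.1) + (q - y.2.2), y.2.1, y.2.1 - y.1⟩
      else ⟨q - y.1, y.2.1, q - y.1 - (q - y.2.2)⟩) ?_ ?_ ?_ ?_ ?_
  · rintro ⟨k, r, r'⟩ h
    simp only [Finset.mem_sigma, Finset.mem_range, Finset.mem_Icc] at h ⊢
    omega
  · rintro ⟨t, r, ρ⟩ h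
    simp only [Finset.mem_sigma, Finset.mem_Icc] at h
    simp only [Finset.mem_sigma, Finset.mem_range]
    split_ifs <;> dsimp only <;> omega
  · rintro ⟨k, r, r'⟩ h
    simp only [Finset.mem_sigma, Finset.mem_range] at h
    dsimp only
    split_ifs
    · rw [show r - min (r - r') (q - k) = r' by omega,
        show r' + (q - (q - (k - r'))) = k by omega]
    · rw [show q - min (r - r') (q - k) = k by omega,
        show k - (q - (q - (k - r'))) = r' by omega]
  · rintro ⟨t, r, ρ⟩ h
    simp only [Finset.mem_sigma, Finset.mem_Icc] at h
    dsimp only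
    split_ifs
    · dsimp only
      rw [show min (r - (r - t)) (q - (r - t + (q - ρ))) = t by omega,
        show q - (r - t + (q - ρ) - (r - t)) = ρ by omega]
    · dsimp only
      rw [show min (r - (q - t - (q - ρ))) (q - (q - t)) = t by omega,
        show q - (q - t - (q - t - (q - ρ))) = ρ by omega]
  · rintro ⟨k, r, r'⟩ h
    simp only [Finset.mem_sigma, Finset.mem_range] at h
    dsimp only
    rcases le_or_gt (r - r') (q - k) with hd | hd
    · rw [min_eq_left hd]
      exact h₁ k r r' h.2.2 (by omega) h.1 hd
    · rw [min_eq_right hd.le]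
      exact h₂ k r r' h.2.2 (by omega) h.1 hd

theorem sum_tripleContraction_offDiag_nonneg (q : ℕ) {f : List ι → ℝ}
    (hrev : ∀ w, f w.reverse = f w) :
    0 ≤ ∑ k ∈ Finset.range q, ∑ r ∈ Finset.range (k + 1), ∑ r' ∈ Finset.range r,
      ∑ w ∈ words ι (3 * q - 2 * k), tripleContraction q k r f w * tripleContraction q k r' f w := by
  rw [sum_offDiag_reindex q _ (fun t r ρ => ∑ x ∈ words ι (q - 2 * t),
      triangleContraction q t r f x * triangleContraction q t ρ f x)
    (fun _ _ _ => sum_tripleContraction_mul_of_le hrev)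
    (fun _ _ _ => sum_tripleContraction_mul_of_lt hrev)]
  refine Finset.sum_nonneg fun t _ => ?_
  have : ∑ r ∈ Finset.Icc t (q - t), ∑ ρ ∈ Finset.Icc t (q - t),
      ∑ x ∈ words ι (q - 2 * t), triangleContraction q t r f x * triangleContraction q t ρ f x =
      ∑ x ∈ words ι (q - 2 * t), (∑ r ∈ Finset.Icc t (q - t), triangleContraction q t r f x) ^ 2 := by
    simp only [sq, Finset.sum_mul_sum]
    rw [Finset.sum_comm (s := words ι (q - 2 * t))]
    exact Finset.sum_congr rfl fun r _ => Finset.sum_comm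
  rw [this]
  exact Finset.sum_nonneg fun _ _ => sq_nonneg _

theorem sum_normSqOrder_tripleContraction_le (q : ℕ) {f : List ι → ℝ}
    (hrev : ∀ w, f w.reverse = f w) :
    ∑ k ∈ Finset.range q, ∑ r ∈ Finset.range (k + 1),
      normSqOrder (3 * q - 2 * k) (tripleContraction q k r f) ≤
    ∑ k ∈ Finset.range q, normSqOrder (3 * q - 2 * k)
      fun w => ∑ r ∈ Finset.range (k + 1), tripleContraction q k r f w := by
  have h := sum_tripleContraction_offDiag_nonneg q hrev
  have h2 : ∀ k, normSqOrder (3 * q - 2 * k)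
      (fun w => ∑ r ∈ Finset.range (k + 1), tripleContraction q k r f w) =
      ∑ r ∈ Finset.range (k + 1), normSqOrder (3 * q - 2 * k) (tripleContraction q k r f) +
      2 * ∑ r ∈ Finset.range (k + 1), ∑ r' ∈ Finset.range r, ∑ w ∈ words ι (3 * q - 2 * k),
        tripleContraction q k r f w * tripleContraction q k r' f w := by
    intro k
    simp only [normSqOrder, sum_range_sq_eq]
    rw [Finset.sum_add_distrib, ← Finset.mul_sum]
    congr 1
    · exact Finset.sum_comm
    · congr 1
      rw [Finset.sum_comm]
      exact Finset.sum_congr rfl fun r _ => Finset.sum_comm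
  simp only [h2, Finset.sum_add_distrib, ← Finset.mul_sum]
  linarith

/-- A kernel of order `q`: supported on words of length `q` with distinct neighbours, and mirror
symmetric. -/
structure IsMirrorKernel (q : ℕ) (f : List ι → ℝ) : Prop where
  length_eq : ∀ w, f w ≠ 0 → w.length = q
  isChain : ∀ w, f w ≠ 0 → w.IsChain (· ≠ ·)
  reverse : ∀ w, f w.reverse = f w

/-- The contraction `f ⌢^r f`, for words of length `2 (q - r)`. -/
def contraction (q r : ℕ) (f : List ι → ℝ) (w : List ι) : ℝ :=
  ∑ a ∈ words ι r, f (w.take (q - r) ++ a) * f (a.reverse ++ w.drop (q - r))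

variable [DecidableEq ι] {q : ℕ} {f : List ι → ℝ}

theorem IsMirrorKernel.fockOp_one (hf : IsMirrorKernel q f) (w : List ι) :
    (fockOp q f ^ 1) (Finsupp.single [] 1) w = f w := by
  rw [pow_one, fockOp_apply hf.isChain, Finset.sum_eq_single q]
  · simp only [Nat.sub_self, sum_words_zero, List.append_nil, List.reverse_nil, List.nil_append]
    split_ifs with h
    · rcases h.eq_or_lt with h | h
      · simp [h]
      · have h0 : f w = 0 := by
          by_contra h0
          exact h.ne' (hf.length_eq w h0)
        have : w.drop q ≠ [] := by simp [h]
        simp [h0, this.symm]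
    · by_contra h0
      exact h (hf.length_eq w (Ne.symm h0)).ge
  · intro j hj hne
    have hj' := Finset.mem_range_succ_iff.1 hj
    split_ifs with h
    · refine Finset.sum_eq_zero fun a ha => ?_
      have : a ≠ [] := by
        rintro rfl
        simp only [mem_words, List.length_nil] at ha
        omega
      simp [this]
    · rfl
  · simp

theorem IsMirrorKernel.fockOp_two (hf : IsMirrorKernel q f) {r : ℕ} (hr : r ≤ q) {w : List ι}
    (hw : w.length = 2 * (q - r)) :
    (fockOp q f ^ 2) (Finsupp.single [] 1) w = contraction q r f w := by
  rw [pow_succ', Module.End.mul_apply, fockOp_apply hf.isChain, Finset.sum_eq_single (q - r)]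
  · rw [if_pos (by omega), show q - (q - r) = r by omega]
    simp only [hf.fockOp_one]
    rfl
  · intro j hj hne
    split_ifs with h
    · refine Finset.sum_eq_zero fun a ha => ?_
      rw [hf.fockOp_one]
      by_contra h0
      have := hf.length_eq _ (right_ne_zero_of_mul h0)
      simp only [mem_words] at ha
      simp only [List.length_append, List.length_reverse, List.length_drop] at this
      have := Finset.mem_range_succ_iff.1 hj
      omega
    · rfl
  · intro h
    exact absurd (Finset.mem_range_succ_iff.2 (Nat.sub_le q r)) h

theorem IsMirrorKernel.length_of_fockOp_two (hf : IsMirrorKernel q f) {w : List ι}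
    (hw : (fockOp q f ^ 2) (Finsupp.single [] 1) w ≠ 0) : ∃ r ≤ q, w.length = 2 * (q - r) := by
  rw [pow_succ', Module.End.mul_apply, fockOp_apply hf.isChain] at hw
  obtain ⟨j, hj, h⟩ := Finset.exists_ne_zero_of_sum_ne_zero hw
  have := Finset.mem_range_succ_iff.1 hj
  split_ifs at h with hjw
  · obtain ⟨a, ha, h⟩ := Finset.exists_ne_zero_of_sum_ne_zero h
    rw [hf.fockOp_one] at h
    have := hf.length_eq _ (right_ne_zero_of_mul h)
    simp only [mem_words] at ha
    simp only [List.length_append, List.length_reverse, List.length_drop] at this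
    exact ⟨q - j, by omega, by omega⟩
  · exact absurd rfl h

theorem IsMirrorKernel.fockOp_three (hf : IsMirrorKernel q f) {k : ℕ} (hk : k ≤ q) {w : List ι}
    (hw : w.length = 3 * q - 2 * k) :
    (fockOp q f ^ 3) (Finsupp.single [] 1) w =
      ∑ r ∈ Finset.range (k + 1), tripleContraction q k r f w := by
  rw [pow_succ', Module.End.mul_apply, fockOp_apply hf.isChain, ← Finset.sum_range_reflect]
  refine (Finset.sum_subset (Finset.range_mono (by omega : k + 1 ≤ q + 1)) ?_).symm.trans
    (Finset.sum_congr rfl fun r hr => ?_)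
  · intro r hr hrk
    rw [Finset.mem_range] at hr hrk
    rw [if_pos (by omega)]
    refine Finset.sum_eq_zero fun a ha => ?_
    rw [mem_words] at ha
    by_contra h0
    obtain ⟨s, hs, h⟩ := hf.length_of_fockOp_two (right_ne_zero_of_mul h0)
    simp only [List.length_append, List.length_reverse, List.length_drop] at h
    omega
  · rw [Finset.mem_range] at hr
    rw [if_pos (by omega), tripleContraction, show q + 1 - 1 - r = q - r by omega,
      show q - (q - r) = r by omega]
    refine Finset.sum_congr rfl fun a ha => ?_
    rw [mem_words] at ha
    rw [hf.fockOp_two (r := k - r) (by omega) (by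
      simp only [List.length_append, List.length_reverse, List.length_drop]; omega),
      contraction, Finset.mul_sum]
    refine Finset.sum_congr rfl fun b _ => ?_
    rw [show q - (k - r) = a.reverse.length + (q - k) by simp; omega, List.take_length_add_append,
      List.drop_length_add_append, List.append_assoc, mul_assoc]

end SixthMoment

section SixthMomentBound

variable {ι : Type*} [Fintype ι]

theorem normSqOrder_tripleContraction_zero {q k : ℕ} (hk : k ≤ q) (f : List ι → ℝ) :
    normSqOrder (3 * q - 2 * k) (tripleContraction q k 0 f) =
      normSqOrder q f * normSqOrder (2 * (q - k)) (contraction q k f) := by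
  rw [show 3 * q - 2 * k = q + 2 * (q - k) by omega, normSqOrder, sum_words_add, normSqOrder,
    normSqOrder, Finset.sum_mul_sum]
  refine Finset.sum_congr rfl fun u hu => Finset.sum_congr rfl fun v hv => ?_
  rw [mem_words] at hu hv
  rw [← mul_pow, tripleContraction, sum_words_zero, contraction, Finset.mul_sum, Nat.sub_zero,
    Nat.sub_zero, List.take_left' hu, List.drop_left' hu]
  simp [mul_assoc]

theorem normSqOrder_tripleContraction_self {q k : ℕ} (hk : k ≤ q) (f : List ι → ℝ) :
    normSqOrder (3 * q - 2 * k) (tripleContraction q k k f) =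
      normSqOrder q f * normSqOrder (2 * (q - k)) (contraction q k f) := by
  rw [show 3 * q - 2 * k = 2 * (q - k) + q by omega, normSqOrder, sum_words_add,
    mul_comm (normSqOrder q f), normSqOrder, normSqOrder, Finset.sum_mul_sum]
  refine Finset.sum_congr rfl fun u hu => Finset.sum_congr rfl fun v hv => ?_
  rw [mem_words] at hu hv
  rw [← mul_pow, tripleContraction, contraction, Finset.sum_mul, Nat.sub_self]
  simp only [sum_words_zero, List.append_nil, List.reverse_nil, List.nil_append]
  rw [List.take_append_of_le_length (by omega), List.drop_append_of_le_length (by omega),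
    List.take_left' (by simp; omega), List.drop_left' (by simp; omega)]

theorem normSqOrder_contraction_zero (q : ℕ) (f : List ι → ℝ) :
    normSqOrder (2 * q) (contraction q 0 f) = normSqOrder q f ^ 2 := by
  rw [two_mul, normSqOrder, sum_words_add, sq, normSqOrder, Finset.sum_mul_sum]
  refine Finset.sum_congr rfl fun u hu => Finset.sum_congr rfl fun v hv => ?_
  rw [mem_words] at hu
  rw [← mul_pow, contraction, sum_words_zero, Nat.sub_zero, List.take_left' hu, List.drop_left' hu]
  simp

theorem normSqOrder_contraction_self (q : ℕ) {f : List ι → ℝ} (hrev : ∀ w, f w.reverse = f w) :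
    normSqOrder 0 (contraction q q f) = normSqOrder q f ^ 2 := by
  rw [normSqOrder, sum_words_zero, contraction]
  simp [hrev, normSqOrder, sq]

variable [DecidableEq ι] {q : ℕ} {f : List ι → ℝ}

theorem IsMirrorKernel.fockNormSq_two (hf : IsMirrorKernel q f) (hq : 1 ≤ q) :
    fockNormSq ((fockOp q f ^ 2) (Finsupp.single [] 1)) = 2 * normSqOrder q f ^ 2 +
      ∑ k ∈ Finset.Ico 1 q, normSqOrder (2 * (q - k)) (contraction q k f) := by
  have h1 : ∀ w, (fockOp q f ^ 2) (Finsupp.single [] 1) w ≠ 0 → w.length < 2 * q + 1 := by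
    intro w hw
    obtain ⟨r, _, h⟩ := hf.length_of_fockOp_two hw
    omega
  rw [fockNormSq_eq _ _ h1]
  have h2 : ∑ k ∈ Finset.range (q + 1), normSqOrder (2 * (q - k)) (contraction q k f) =
      ∑ n ∈ Finset.range (2 * q + 1), normSqOrder n ((fockOp q f ^ 2) (Finsupp.single [] 1)) := by
    refine Finset.sum_of_injOn (fun k => 2 * (q - k)) ?_ ?_ ?_ ?_
    · intro a ha b hb h
      simp only [Finset.coe_range, Set.mem_Iio] at ha hb h
      omega
    · intro a ha
      simp only [Finset.coe_range, Set.mem_Iio] at ha ⊢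
      omega
    · intro n hn hn'
      refine Finset.sum_eq_zero fun w hw => ?_
      by_contra h0
      rw [mem_words] at hw
      obtain ⟨r, hr, h⟩ := hf.length_of_fockOp_two (w := w) (fun h => h0 (by rw [h]; simp))
      exact hn' ⟨r, by simp; omega, by simp only; omega⟩
    · intro k hk
      refine Finset.sum_congr rfl fun w hw => ?_
      rw [hf.fockOp_two (Finset.mem_range_succ_iff.1 hk) (mem_words.1 hw)]
  rw [← h2, Finset.range_eq_Ico, Finset.sum_Ico_succ_top (by omega),
    Finset.sum_eq_sum_Ico_succ_bot (by omega), Nat.sub_self, Nat.sub_zero, mul_zero,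
    normSqOrder_contraction_zero, normSqOrder_contraction_self q hf.reverse]
  ring

theorem IsMirrorKernel.le_fockNormSq_three (hf : IsMirrorKernel q f) (hq : 3 ≤ q) :
    normSqOrder q f ^ 3 + 2 * normSqOrder q f *
      ∑ k ∈ Finset.Ico 1 q, normSqOrder (2 * (q - k)) (contraction q k f) +
      normSqOrder (3 * q - 4) (tripleContraction q 2 1 f) +
      normSqOrder q ((fockOp q f ^ 3) (Finsupp.single [] 1)) ≤
    fockNormSq ((fockOp q f ^ 3) (Finsupp.single [] 1)) := by
  set v := (fockOp q f ^ 3) (Finsupp.single [] 1) with hv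
  have h1 : ∑ k ∈ Finset.range (q + 1), normSqOrder (3 * q - 2 * k) v ≤ fockNormSq v := by
    rw [← Finset.sum_image (f := fun n => normSqOrder n v) (g := fun k => 3 * q - 2 * k)]
    · exact sum_normSqOrder_le _ _
    · intro a ha b hb h
      simp only [Finset.coe_range, Set.mem_Iio] at ha hb h
      omega
  have h2 : ∑ k ∈ Finset.range q, normSqOrder (3 * q - 2 * k) v =
      ∑ k ∈ Finset.range q, normSqOrder (3 * q - 2 * k)
        fun w => ∑ r ∈ Finset.range (k + 1), tripleContraction q k r f w := by
    refine Finset.sum_congr rfl fun k hk => Finset.sum_congr rfl fun w hw => ?_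
    rw [hv, hf.fockOp_three (Finset.mem_range.1 hk).le (mem_words.1 hw)]
  have h3 := sum_normSqOrder_tripleContraction_le q hf.reverse
  have h4 : ∀ k ∈ Finset.Ico 1 q, 2 * normSqOrder q f *
      normSqOrder (2 * (q - k)) (contraction q k f) +
      (if k = 2 then normSqOrder (3 * q - 4) (tripleContraction q 2 1 f) else 0) ≤
      ∑ r ∈ Finset.range (k + 1), normSqOrder (3 * q - 2 * k) (tripleContraction q k r f) := by
    intro k hk
    rw [Finset.mem_Ico] at hk
    rw [Finset.sum_range_succ, Finset.range_eq_Ico, Finset.sum_eq_sum_Ico_succ_bot (by omega),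
      normSqOrder_tripleContraction_zero hk.2.le, normSqOrder_tripleContraction_self hk.2.le]
    split_ifs with h
    · subst h
      simp
      linarith
    · have : 0 ≤ ∑ r ∈ Finset.Ico (0 + 1) k,
          normSqOrder (3 * q - 2 * k) (tripleContraction q k r f) :=
        Finset.sum_nonneg fun _ _ => normSqOrder_nonneg _ _
      linarith
  have h5 := Finset.sum_le_sum h4
  rw [Finset.sum_add_distrib, ← Finset.mul_sum, Finset.sum_ite_eq' (Finset.Ico 1 q) 2,
    if_pos (by simp; omega)] at h5
  rw [Finset.range_eq_Ico, Finset.sum_eq_sum_Ico_succ_bot (by omega)] at h3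
  have h6 : normSqOrder (3 * q - 2 * 0) (tripleContraction q 0 0 f) = normSqOrder q f ^ 3 := by
    rw [normSqOrder_tripleContraction_zero (Nat.zero_le q), Nat.sub_zero,
      normSqOrder_contraction_zero]
    ring
  rw [Finset.sum_range_succ, h2, Finset.range_eq_Ico, show 3 * q - 2 * q = q by omega] at h1
  simp only [zero_add, Finset.sum_range_one, h6] at h3
  linarith

variable {A : Type*} [Ring A] [Algebra ℂ A] [StarRing A] [StarModule ℂ A]

/-- A lower bound of the sixth moment of a Wigner integral by its second and fourth moments. -/
theorem IsMirrorKernel.sixth_moment_bound (hf : IsMirrorKernel q f) (hq : 3 ≤ q)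
    {φ : A →ₗ[ℂ] ℂ} {x : ι → A} (hx : IsSemicircularSystem φ x) (hsa : ∀ i, IsSelfAdjoint (x i))
    {m₂ m₄ m₆ : ℝ} (h₂ : φ (wordSum x q f ^ 2) = m₂) (h₄ : φ (wordSum x q f ^ 4) = m₄)
    (h₆ : φ (wordSum x q f ^ 6) = m₆) :
    m₂ ^ 4 + m₄ ^ 2 + 2 * m₂ ^ 2 * (m₄ - 2 * m₂ ^ 2) +
      m₂ * normSqOrder (3 * q - 4) (tripleContraction q 2 1 f) ≤ m₂ * m₆ := by
  have hX : star (wordSum x q f) = wordSum x q f := by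
    rw [star_wordSum hsa]
    simp only [hf.reverse]
  have hv1 : ∀ w, (fockOp q f ^ 1) (Finsupp.single [] 1) w ≠ 0 → w.length < q + 1 := by
    intro w hw
    rw [hf.fockOp_one] at hw
    exact (hf.length_eq w hw).le.trans_lt (Nat.lt_succ_self q)
  have hlt : ∀ n ∈ Finset.range q, ∀ w ∈ words ι n, f w = 0 := by
    intro n hn w hw
    by_contra h0
    have := hf.length_eq w h0
    rw [mem_words] at hw
    rw [Finset.mem_range] at hn
    omega
  have e2 : m₂ = normSqOrder q f := by
    have := map_star_pow_mul_pow_wordSum hx hsa q f 1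
    rw [fockNormSq_eq _ _ hv1, star_pow, hX, ← pow_add, h₂, Finset.sum_range_succ,
      Finset.sum_eq_zero, zero_add] at this
    · rw [Complex.ofReal_inj.1 this]
      simp only [normSqOrder, hf.fockOp_one]
    · intro n hn
      refine Finset.sum_eq_zero fun w hw => ?_
      rw [hf.fockOp_one, hlt n hn w hw, sq, zero_mul]
  have e4 : m₄ = fockNormSq ((fockOp q f ^ 2) (Finsupp.single [] 1)) := by
    have := map_star_pow_mul_pow_wordSum hx hsa q f 2
    rw [star_pow, hX, ← pow_add, h₄] at this
    exact Complex.ofReal_inj.1 this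
  have e6 : m₆ = fockNormSq ((fockOp q f ^ 3) (Finsupp.single [] 1)) := by
    have := map_star_pow_mul_pow_wordSum hx hsa q f 3
    rw [star_pow, hX, ← pow_add, h₆] at this
    exact Complex.ofReal_inj.1 this
  have e4' : m₄ = ∑ w ∈ words ι q, f w * (fockOp q f ^ 3) (Finsupp.single [] 1) w := by
    have := hx.map_star_wickSum_mul hsa ((fockOp q f ^ 1) (Finsupp.single [] 1))
      ((fockOp q f ^ 3) (Finsupp.single [] 1))
    rw [← wordSum_pow, ← wordSum_pow, star_pow, hX, ← pow_add, h₄, sum_mul_eq_sum_range _ _ _ hv1,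
      Finset.sum_range_succ, Finset.sum_eq_zero, zero_add] at this
    · rw [Complex.ofReal_inj.1 this]
      simp only [hf.fockOp_one]
    · intro n hn
      refine Finset.sum_eq_zero fun w hw => ?_
      rw [hf.fockOp_one, hlt n hn w hw, zero_mul]
  have cs : m₄ ^ 2 ≤ m₂ * normSqOrder q ((fockOp q f ^ 3) (Finsupp.single [] 1)) := by
    rw [e4', e2]
    exact Finset.sum_mul_sq_le_sq_mul_sq _ _ _
  have h4 := hf.fockNormSq_two (by omega)
  have h6 := hf.le_fockNormSq_three hq
  rw [← e4, ← e2] at h4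
  rw [← e6, ← e2] at h6
  have hm : 0 ≤ m₂ := e2 ▸ normSqOrder_nonneg _ _
  have := mul_le_mul_of_nonneg_left h6 hm
  rw [h4] at cs ⊢
  nlinarith

end SixthMomentBound

section ProductTensor

variable {ι : Type*} [Fintype ι]

theorem sum_triple_chain {α : Type*} (U V P : Finset α) (F : α → α → α → ℝ)
    (η η' h g : α → ℝ) :
    ∑ u ∈ U, (∑ v' ∈ V, ∑ y' ∈ P, F v' y' u * (h v' * η' y')) *
      (∑ y ∈ P, ∑ v ∈ V, F u y v * η y * ∑ y₂ ∈ P, ∑ u₂ ∈ U, F v y₂ u₂ * (η' y₂ * g u₂)) =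
    ∑ v' ∈ V, ∑ y' ∈ P, ∑ y ∈ P, ∑ y₂ ∈ P, ∑ u₂ ∈ U,
      (∑ u ∈ U, ∑ v ∈ V, F v' y' u * F u y v * F v y₂ u₂) *
        (h v' * η' y' * η y * η' y₂ * g u₂) := by
  simp only [Finset.sum_mul, Finset.mul_sum]
  simp only [← Finset.sum_product']
  refine Finset.sum_nbij' (fun (u, y, v, y₂, u₂, v', y') => (v', y', y, y₂, u₂, u, v))
    (fun (v', y', y, y₂, u₂, u, v) => (u, y, v, y₂, u₂, v', y')) ?_ ?_ ?_ ?_ ?_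
  · rintro ⟨u, y, v, y₂, u₂, v', y'⟩ h
    simp only [Finset.mem_product] at h ⊢
    tauto
  · rintro ⟨v', y', y, y₂, u₂, u, v⟩ h
    simp only [Finset.mem_product] at h ⊢
    tauto
  · exact fun _ _ => rfl
  · exact fun _ _ => rfl
  · exact fun _ _ => by ring

theorem sum_rotate {α : Type*} (U V P : Finset α) (G : α → α → α → ℝ) :
    ∑ v ∈ V, ∑ u ∈ U, ∑ y ∈ P, G u y v = ∑ u ∈ U, ∑ y ∈ P, ∑ v ∈ V, G u y v := by
  rw [Finset.sum_comm]
  exact Finset.sum_congr rfl fun u _ => Finset.sum_comm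

theorem sum_five_mul_sq_le {α : Type*} (A B C D E : Finset α) (c : α → α → α → α → α → ℝ)
    (a b₁ b₂ b₃ e : α → ℝ) :
    (∑ v ∈ A, ∑ y ∈ B, ∑ z ∈ C, ∑ w ∈ D, ∑ u ∈ E, c v y z w u *
      (a v * b₁ y * b₂ z * b₃ w * e u)) ^ 2 ≤
    (∑ v ∈ A, ∑ y ∈ B, ∑ z ∈ C, ∑ w ∈ D, ∑ u ∈ E, c v y z w u ^ 2) *
      ((∑ v ∈ A, a v ^ 2) * ((∑ y ∈ B, b₁ y ^ 2) * ((∑ z ∈ C, b₂ z ^ 2) * ((∑ w ∈ D, b₃ w ^ 2) *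
        ∑ u ∈ E, e u ^ 2)))) := by
  have h : (∑ v ∈ A, a v ^ 2) * ((∑ y ∈ B, b₁ y ^ 2) * ((∑ z ∈ C, b₂ z ^ 2) *
      ((∑ w ∈ D, b₃ w ^ 2) * ∑ u ∈ E, e u ^ 2))) = ∑ v ∈ A, ∑ y ∈ B, ∑ z ∈ C, ∑ w ∈ D, ∑ u ∈ E,
        (a v * b₁ y * b₂ z * b₃ w * e u) ^ 2 := by
    rw [Finset.sum_mul_sum, Finset.sum_mul_sum, Finset.sum_mul_sum, Finset.sum_mul_sum]
    simp only [mul_pow, Finset.mul_sum, mul_assoc]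
  rw [h]
  simp only [← Finset.sum_product']
  exact Finset.sum_mul_sq_le_sq_mul_sq _ _ _

/-- If `f` is mirror symmetric, its correlation with a product tensor is controlled by the
contraction `(f ⌢^1 f) ⌢^1 f`. -/
theorem sum_mul_pow_six_le {p : ℕ} {f b : List ι → ℝ} (hrev : ∀ w, f w.reverse = f w)
    {g η h : List ι → ℝ} (hb : ∀ u ∈ words ι 1, ∀ y ∈ words ι p, ∀ v ∈ words ι 1,
      b (u ++ (y ++ v)) = g u * η y * h v) :
    (∑ w ∈ words ι (1 + (p + 1)), f w * b w) ^ 6 ≤ normSqOrder (1 + (p + 1)) b ^ 3 *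
      normSqOrder (1 + (p + (p + (p + 1)))) (tripleContraction (1 + (p + 1)) 2 1 f) := by
  set F : List ι → List ι → List ι → ℝ := fun u y v => f (u ++ (y ++ v)) with hF
  set W := words ι 1 with hW
  set P := words ι p with hP
  have hrW : ∀ u ∈ W, u.reverse = u := by
    intro u hu
    rw [hW, mem_words, List.length_eq_one_iff] at hu
    obtain ⟨i, rfl⟩ := hu
    rfl
  have hFr : ∀ u ∈ W, ∀ y, ∀ v ∈ W, F v y.reverse u = F u y v := by
    intro u hu y v hv
    simp only [hF]
    rw [← hrev (u ++ _)]
    simp [hrW u hu, hrW v hv]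
  set h₀ : List ι → ℝ := fun v => ∑ y ∈ P, ∑ u ∈ W, F v y u * (η y.reverse * g u) with hh
  set k : List ι → ℝ := fun u => ∑ v ∈ W, ∑ y ∈ P, F v y u * (h₀ v * η y.reverse) with hk
  have hh' : ∀ v ∈ W, h₀ v = ∑ u ∈ W, ∑ y ∈ P, F u y v * (g u * η y) := by
    intro v hv
    rw [hh]
    dsimp only
    rw [hP, ← sum_words_reverse, Finset.sum_comm]
    refine Finset.sum_congr rfl fun u hu => Finset.sum_congr rfl fun y _ => ?_
    rw [hFr u hu y v hv, List.reverse_reverse, mul_comm (η y)]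
  have hk' : ∀ u ∈ W, k u = ∑ y ∈ P, ∑ v ∈ W, F u y v * η y * h₀ v := by
    intro u hu
    rw [hk]
    dsimp only
    rw [Finset.sum_comm, hP, ← sum_words_reverse]
    refine Finset.sum_congr rfl fun y _ => Finset.sum_congr rfl fun v hv => ?_
    rw [hFr u hu y v hv, List.reverse_reverse]
    ring
  have e1 : ∑ w ∈ words ι (1 + (p + 1)), f w * b w = ∑ v ∈ W, h₀ v * h v := by
    have : ∑ v ∈ W, h₀ v * h v = ∑ v ∈ W, ∑ u ∈ W, ∑ y ∈ P, F u y v * (g u * η y) * h v := by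
      refine Finset.sum_congr rfl fun v hv => ?_
      rw [congrArg (· * h v) (hh' v hv)]
      simp only [Finset.sum_mul]
    rw [this, sum_rotate, sum_words_add]
    refine Finset.sum_congr rfl fun u hu => ?_
    rw [sum_words_add]
    refine Finset.sum_congr rfl fun y hy => Finset.sum_congr rfl fun v hv => ?_
    rw [hb u hu y hy v hv]
    simp only [hF]
    ring
  have e2 : ∑ v ∈ W, h₀ v ^ 2 = ∑ u ∈ W, g u * k u := by
    have : ∑ v ∈ W, h₀ v ^ 2 = ∑ v ∈ W, ∑ u ∈ W, ∑ y ∈ P, h₀ v * (F u y v * (g u * η y)) := by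
      refine Finset.sum_congr rfl fun v hv => ?_
      rw [sq, congrArg (h₀ v * ·) (hh' v hv)]
      simp only [Finset.mul_sum]
    rw [this, sum_rotate]
    refine Finset.sum_congr rfl fun u hu => ?_
    rw [congrArg (g u * ·) (hk' u hu)]
    simp only [Finset.mul_sum]
    exact Finset.sum_congr rfl fun y _ => Finset.sum_congr rfl fun v _ => by ring
  have e3 : ∑ u ∈ W, k u ^ 2 = ∑ v' ∈ W, ∑ y' ∈ P, ∑ y ∈ P, ∑ y₂ ∈ P, ∑ u₂ ∈ W,
      (∑ u ∈ W, ∑ v ∈ W, F v' y' u * F u y v * F v y₂ u₂) *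
        (h₀ v' * η y'.reverse * η y * η y₂.reverse * g u₂) := by
    rw [← sum_triple_chain W W P F η (fun y => η y.reverse) h₀ g]
    refine Finset.sum_congr rfl fun u hu => ?_
    rw [sq, congrArg (k u * ·) (hk' u hu)]
  have e4 : normSqOrder (1 + (p + (p + (p + 1)))) (tripleContraction (1 + (p + 1)) 2 1 f) =
      ∑ v' ∈ W, ∑ y' ∈ P, ∑ y ∈ P, ∑ y₂ ∈ P, ∑ u₂ ∈ W,
      (∑ u ∈ W, ∑ v ∈ W, F v' y' u * F u y v * F v y₂ u₂) ^ 2 := by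
    rw [normSqOrder, sum_words_add_five]
    refine Finset.sum_congr rfl fun v' hv' => ?_
    refine Finset.sum_congr rfl fun y' hy' => ?_
    refine Finset.sum_congr rfl fun y hy => ?_
    refine Finset.sum_congr rfl fun y₂ hy₂ => ?_
    refine Finset.sum_congr rfl fun u₂ hu₂ => ?_
    rw [tripleContraction]
    congr 1
    refine Finset.sum_congr rfl fun u hu => Finset.sum_congr rfl fun v hv => ?_
    have h1 : 1 + (p + 1) - 1 = (v' ++ y').length := by
      simp only [hW, hP, mem_words] at hv' hy'
      simp
      omega
    have h2 : 1 + (p + 1) - 2 = y.length := by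
      simp only [hP, mem_words] at hy
      omega
    rw [h1, h2, ← List.append_assoc v', List.take_left, List.drop_left, List.take_left,
      List.drop_left, hrW u hu, hrW v hv, List.append_assoc]
  have e5 : normSqOrder (1 + (p + 1)) b =
      (∑ u ∈ W, g u ^ 2) * ((∑ y ∈ P, η y ^ 2) * ∑ v ∈ W, h v ^ 2) := by
    rw [normSqOrder, sum_words_add, Finset.sum_mul_sum, Finset.sum_mul_sum]
    refine Finset.sum_congr rfl fun u hu => ?_
    rw [sum_words_add]
    refine Finset.sum_congr rfl fun y hy => ?_
    rw [Finset.mul_sum]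
    refine Finset.sum_congr rfl fun v hv => ?_
    rw [hb u hu y hy v hv]
    ring
  have c1 := Finset.sum_mul_sq_le_sq_mul_sq W h₀ h
  have c2 := Finset.sum_mul_sq_le_sq_mul_sq W g k
  have c3 := sum_five_mul_sq_le W P P P W
    (fun v' y' y y₂ u₂ => ∑ u ∈ W, ∑ v ∈ W, F v' y' u * F u y v * F v y₂ u₂) h₀
    (fun y => η y.reverse) η (fun y => η y.reverse) g
  have hη : ∑ y ∈ P, η y.reverse ^ 2 = ∑ y ∈ P, η y ^ 2 := sum_words_reverse p fun y => η y ^ 2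
  rw [← e3, ← e4, hη] at c3
  rw [← e1] at c1
  rw [← e2] at c2
  rw [e5]
  have hC : 0 ≤ normSqOrder (1 + (p + (p + (p + 1)))) (tripleContraction (1 + (p + 1)) 2 1 f) :=
    normSqOrder_nonneg _ _
  have hH : 0 ≤ ∑ v ∈ W, h₀ v ^ 2 := Finset.sum_nonneg fun _ _ => sq_nonneg _
  have hG : 0 ≤ ∑ u ∈ W, g u ^ 2 := Finset.sum_nonneg fun _ _ => sq_nonneg _
  have hE : 0 ≤ ∑ y ∈ P, η y ^ 2 := Finset.sum_nonneg fun _ _ => sq_nonneg _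
  have hK : 0 ≤ ∑ u ∈ W, k u ^ 2 := Finset.sum_nonneg fun _ _ => sq_nonneg _
  have hT : 0 ≤ ∑ v ∈ W, h v ^ 2 := Finset.sum_nonneg fun _ _ => sq_nonneg _
  generalize normSqOrder (1 + (p + (p + (p + 1)))) (tripleContraction (1 + (p + 1)) 2 1 f) = C at *
  generalize ∑ v ∈ W, h₀ v ^ 2 = H at *
  generalize ∑ u ∈ W, g u ^ 2 = G at *
  generalize ∑ y ∈ P, η y ^ 2 = E at *
  generalize ∑ u ∈ W, k u ^ 2 = K at *
  generalize ∑ v ∈ W, h v ^ 2 = T at *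
  generalize ∑ w ∈ words ι (1 + (p + 1)), f w * b w = S at *
  have h4 : H ^ 3 ≤ C * E ^ 3 * G ^ 3 := by
    rcases hH.eq_or_lt with h0 | h0
    · rw [← h0, zero_pow three_ne_zero]
      exact mul_nonneg (mul_nonneg hC (pow_nonneg hE 3)) (pow_nonneg hG 3)
    · refine le_of_mul_le_mul_left ?_ h0
      calc H * H ^ 3 = (H ^ 2) ^ 2 := by ring
        _ ≤ (G * K) ^ 2 := pow_le_pow_left₀ (sq_nonneg _) c2 2
        _ = G ^ 2 * K ^ 2 := by ring
        _ ≤ G ^ 2 * (C * (H * (E * (E * (E * G))))) := mul_le_mul_of_nonneg_left c3 (sq_nonneg _)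
        _ = H * (C * E ^ 3 * G ^ 3) := by ring
  calc S ^ 6 = (S ^ 2) ^ 3 := by ring
    _ ≤ (H * T) ^ 3 := pow_le_pow_left₀ (sq_nonneg _) c1 3
    _ = H ^ 3 * T ^ 3 := by ring
    _ ≤ C * E ^ 3 * G ^ 3 * T ^ 3 := mul_le_mul_of_nonneg_right h4 (by positivity)
    _ = (G * (E * T)) ^ 3 * C := by ring

end ProductTensor

/-! ### Semicircular systems from freeness -/

section Freeness

variable {A : Type*} [Ring A] [Algebra ℂ A]

theorem FreelyIndependent.map_list_prod {φ : A →ₗ[ℂ] ℂ} {κ : Type*} {B : κ → Subalgebra ℂ A}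
    (h : FreelyIndependent φ B) (l : List (κ × A)) (hl : l ≠ [])
    (hc : l.IsChain fun a b => a.1 ≠ b.1) (hm : ∀ a ∈ l, a.2 ∈ B a.1 ∧ φ a.2 = 0) :
    φ (l.map Prod.snd).prod = 0 := by
  obtain ⟨m, hlen⟩ := Nat.exists_eq_succ_of_ne_zero (mt List.length_eq_zero_iff.1 hl)
  have e : (List.ofFn fun j : Fin (m + 1) => (l[j.1]'(by omega)).2) = l.map Prod.snd := by
    apply List.ext_getElem
    · simp [hlen]
    · intro i h₁ h₂
      rw [List.getElem_ofFn, List.getElem_map]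
  rw [← e]
  refine h m (fun j => (l[j.1]'(by omega)).1) _ (fun j => ?_) (fun j => ?_) fun j => ?_
  · exact List.isChain_iff_getElem.1 hc j.1 (by have := j.2; omega)
  · exact (hm _ (List.getElem_mem _)).1
  · exact (hm _ (List.getElem_mem _)).2

variable {ι : Type*} [DecidableEq ι]

omit [Algebra ℂ A] in
theorem wick_append (x : ι → A) : ∀ u v : List ι, (∀ i ∈ u, ∀ j ∈ v.head?, i ≠ j) →
    wick x (u ++ v) = wick x u * wick x v
  | [], v, _ => by simp [wick]
  | [i], [], _ => by simp [wick]
  | [i], j :: v, h => by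
    have : i ≠ j := h i (by simp) j (by simp)
    simp [wick, this]
  | i :: k :: u, v, h => by
    have h1 := wick_append x (k :: u) v fun a ha => h a (List.mem_cons_of_mem _ ha)
    have h2 := wick_append x u v fun a ha =>
      h a (List.mem_cons_of_mem _ (List.mem_cons_of_mem _ ha))
    rw [List.cons_append] at h1
    rw [List.cons_append, List.cons_append, wick, wick, h1, h2, sub_mul, mul_assoc]
    split_ifs <;> simp

theorem wick_replicate (x : ι → A) (i : ι) : ∀ n : ℕ,
    wick x (List.replicate n i) = Polynomial.aeval (x i) (Polynomial.Chebyshev.S ℂ n)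
  | 0 => by simp [wick]
  | 1 => by simp [wick]
  | n + 2 => by
    have h1 := wick_replicate x i n
    have h2 := wick_replicate x i (n + 1)
    rw [List.replicate_succ] at h2
    rw [List.replicate_succ, List.replicate_succ, wick, h2, if_pos rfl, h1]
    push_cast
    rw [Polynomial.Chebyshev.S_add_two]
    simp

omit [DecidableEq ι] in
theorem exists_blocks (p : ι → Bool) (w : List ι) : ∃ bl : List (Bool × List ι),
    (bl.map Prod.snd).flatten = w ∧ (bl.IsChain fun a b => a.1 ≠ b.1) ∧
    ∀ b ∈ bl, b.2 ≠ [] ∧ ∀ i ∈ b.2, p i = b.1 := by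
  induction w with
  | nil => exact ⟨[], by simp⟩
  | cons i w ih =>
    obtain ⟨bl, hw, hc, hb⟩ := ih
    rcases bl with _ | ⟨⟨c, u⟩, bl⟩
    · exact ⟨[(p i, [i])], by simp [← hw]⟩
    · by_cases h : p i = c
      · refine ⟨(c, i :: u) :: bl, by simp [← hw], ?_, ?_⟩
        · rw [List.isChain_cons] at hc ⊢
          exact hc
        · intro b hbm
          rcases List.mem_cons.1 hbm with rfl | hbm
          · refine ⟨by simp, fun j hj => ?_⟩
            rcases List.mem_cons.1 hj with rfl | hj
            · exact h
            · exact (hb (c, u) (by simp)).2 j hj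
          · exact hb b (List.mem_cons_of_mem _ hbm)
      · refine ⟨(p i, [i]) :: (c, u) :: bl, by simp [← hw], List.isChain_cons_cons.2 ⟨h, hc⟩, ?_⟩
        intro b hbm
        rcases List.mem_cons.1 hbm with rfl | hbm
        · simp
        · exact hb b hbm

omit [Algebra ℂ A] in
theorem wick_blocks (x : ι → A) (p : ι → Bool) : ∀ bl : List (Bool × List ι),
    (bl.IsChain fun a b => a.1 ≠ b.1) → (∀ b ∈ bl, b.2 ≠ [] ∧ ∀ i ∈ b.2, p i = b.1) →
    wick x (bl.map Prod.snd).flatten = (bl.map fun b => wick x b.2).prod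
  | [], _, _ => by simp [wick]
  | (c, u) :: bl, hc, hb => by
    rw [List.map_cons, List.flatten_cons, wick_append, wick_blocks x p bl hc.tail
      fun b h => hb b (List.mem_cons_of_mem _ h), List.map_cons, List.prod_cons]
    intro i hi j hj
    rcases bl with _ | ⟨⟨c', u'⟩, bl⟩
    · simp at hj
    · have h1 : c ≠ c' := (List.isChain_cons_cons.1 hc).1
      have h2 := (hb (c, u) (by simp)).2 i hi
      have h3 := hb (c', u') (by simp)
      have h4 : j ∈ u' := by
        rcases u' with _ | ⟨j', u'⟩
        · exact absurd rfl h3.1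
        · simp at hj
          simp [hj]
      rintro rfl
      exact h1 (h2.symm.trans (h3.2 i h4))

theorem wick_mem (x : ι → A) (B : Subalgebra ℂ A) : ∀ w : List ι, (∀ i ∈ w, x i ∈ B) → wick x w ∈ B
  | [], _ => B.one_mem
  | [i], h => h i (by simp)
  | i :: j :: w, h => by
    have h1 := wick_mem x B (j :: w) fun a ha => h a (List.mem_cons_of_mem _ ha)
    have h2 := wick_mem x B w fun a ha => h a (List.mem_cons_of_mem _ (List.mem_cons_of_mem _ ha))
    rw [wick]
    refine B.sub_mem (B.mul_mem (h i (by simp)) h1) ?_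
    split_ifs
    · exact h2
    · exact B.zero_mem

/-- Successively free semicircular random variables form a semicircular system. -/
theorem isSemicircularSystem_of_free {N : ℕ} {φ : A →ₗ[ℂ] ℂ} (h1 : φ 1 = 1) (x : Fin N → A)
    (B : Fin N → Subalgebra ℂ A) (hB : ∀ i j, i < j → x i ∈ B j)
    (hfree : ∀ i, FreelyIndependent φ ![Algebra.adjoin ℂ {x i}, B i])
    (hS : ∀ i (n : ℕ), n ≠ 0 → φ (Polynomial.aeval (x i) (Polynomial.Chebyshev.S ℂ n)) = 0) :
    IsSemicircularSystem φ x := by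
  refine ⟨h1, ?_⟩
  have key : ∀ M : ℕ, ∀ w : List (Fin N), w ≠ [] → (∀ i ∈ w, i.1 < M) → φ (wick x w) = 0 := by
    intro M
    induction M with
    | zero =>
      intro w hw h
      obtain ⟨i, hi⟩ := List.exists_mem_of_ne_nil w hw
      exact absurd (h i hi) (Nat.not_lt_zero _)
    | succ M ih =>
      intro w hw h
      by_cases hM : M < N
      swap
      · exact ih w hw fun i _ => i.2.trans_le (not_lt.1 hM)
      obtain ⟨bl, rfl, hc, hb⟩ := exists_blocks (fun i : Fin N => decide (i.1 = M)) w
      rw [wick_blocks x _ bl hc hb]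
      have hf := hfree ⟨M, hM⟩
      have := hf.map_list_prod (bl.map fun b => (if b.1 then (0 : Fin 2) else 1, wick x b.2)) ?_ ?_ ?_
      · simpa [Function.comp_def] using this
      · rintro h0
        rw [List.map_eq_nil_iff] at h0
        simp [h0] at hw
      · rw [List.isChain_map]
        refine hc.imp fun a b hab => ?_
        rcases a with ⟨_ | _, _⟩ <;> rcases b with ⟨_ | _, _⟩ <;> simp_all
      · intro a ha
        obtain ⟨⟨c, u⟩, hcu, rfl⟩ := List.mem_map.1 ha
        obtain ⟨hu, hu'⟩ := hb _ hcu
        simp only at hu hu'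
        cases c with
        | true =>
          obtain ⟨n, rfl⟩ : ∃ n, u = List.replicate n ⟨M, hM⟩ :=
            ⟨u.length, List.eq_replicate_iff.2 ⟨rfl, fun i hi => Fin.ext (by simpa using hu' i hi)⟩⟩
          simp only [if_true, Matrix.cons_val_zero]
          rw [wick_replicate]
          exact ⟨Polynomial.aeval_mem_adjoin_singleton _ _, hS _ _ (by rintro rfl; simp at hu)⟩
        | false =>
          simp only [Bool.false_eq_true, if_false, Matrix.cons_val_one]
          have hlt : ∀ i ∈ u, i.1 < M := by
            intro i hi
            have h2 : i.1 ≠ M := by simpa using hu' i hi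
            have h3 := h i (List.mem_flatten.2 ⟨u, List.mem_map.2 ⟨_, hcu, rfl⟩, hi⟩)
            omega
          exact ⟨wick_mem x _ u fun i hi => hB i ⟨M, hM⟩ (hlt i hi), ih u hu hlt⟩
  exact fun w hw => key N w hw fun i _ => i.2

end Freeness

/-! ### The semicircular distribution -/

section Semicircular

theorem integral_semicircular {t : ℝ≥0} (ht : t ≠ 0) (g : ℝ → ℝ) :
    ∫ s, g s ∂(semicircular t) = ∫ s in (-(2 * √(t : ℝ)))..(2 * √(t : ℝ)),
      1 / (2 * Real.pi * t) * √(4 * t - s ^ 2) * g s := by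
  have hm : Measurable fun u : ℝ => (Set.Ioo (-(2 * √(t : ℝ))) (2 * √(t : ℝ))).indicator
      (fun u => 1 / (2 * Real.pi * t) * √(4 * t - u ^ 2)) u := by
    refine Measurable.indicator ?_ measurableSet_Ioo
    fun_prop
  rw [semicircular, if_neg ht, integral_withDensity_eq_integral_toReal_smul
    hm.ennreal_ofReal (by simp), intervalIntegral.integral_of_le (by
    have := Real.sqrt_nonneg (t : ℝ); linarith), integral_Ioc_eq_integral_Ioo,
    ← integral_indicator measurableSet_Ioo]
  refine integral_congr_ae (ae_of_all _ fun s => ?_)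
  simp only [Set.indicator_apply]
  split_ifs
  · rw [ENNReal.toReal_ofReal (by positivity), smul_eq_mul]
  · simp

theorem integral_S_semicircular {t : ℝ≥0} (ht : t ≠ 0) {n : ℕ} (hn : n ≠ 0) :
    ∫ s, (Polynomial.Chebyshev.S ℝ n).eval (s / √(t : ℝ)) ∂(semicircular t) = 0 := by
  have ht' : 0 < √(t : ℝ) := Real.sqrt_pos.2 (by positivity)
  rw [integral_semicircular ht]
  have h := intervalIntegral.integral_comp_mul_deriv (a := Real.pi) (b := 0)
    (f := fun θ => 2 * √(t : ℝ) * Real.cos θ) (f' := fun θ => 2 * √(t : ℝ) * -Real.sin θ)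
    (g := fun s => 1 / (2 * Real.pi * t) * √(4 * t - s ^ 2) *
      (Polynomial.Chebyshev.S ℝ n).eval (s / √(t : ℝ)))
    (fun θ _ => (Real.hasDerivAt_cos θ).const_mul _) (by fun_prop) (by fun_prop)
  simp only [Real.cos_pi, Real.cos_zero, mul_one] at h
  rw [mul_neg_one] at h
  rw [← h, intervalIntegral.integral_symm, neg_eq_zero]
  have h2 : ∀ θ ∈ Set.uIcc 0 Real.pi, ((fun s => 1 / (2 * Real.pi * t) * √(4 * t - s ^ 2) *
      (Polynomial.Chebyshev.S ℝ n).eval (s / √(t : ℝ))) ∘ fun θ => 2 * √(t : ℝ) * Real.cos θ) θ *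
      (2 * √(t : ℝ) * -Real.sin θ) = -(1 / Real.pi) *
        (Real.cos (n * θ) - Real.cos ((n + 2) * θ)) := by
    intro θ hθ
    rw [Set.uIcc_of_le Real.pi_pos.le] at hθ
    have hs := Real.sin_nonneg_of_mem_Icc hθ
    have e1 : 4 * (t : ℝ) - (2 * √(t : ℝ) * Real.cos θ) ^ 2 = (2 * √(t : ℝ) * Real.sin θ) ^ 2 := by
      rw [mul_pow, mul_pow, mul_pow, mul_pow, Real.sq_sqrt t.coe_nonneg, Real.sin_sq]
      ring
    have e2 : 2 * √(t : ℝ) * Real.cos θ / √(t : ℝ) = 2 * Real.cos θ := by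
      field_simp
    have e3 := Polynomial.Chebyshev.S_two_mul_real_cos θ n
    have e4 : Real.cos (n * θ) - Real.cos ((n + 2) * θ) =
        2 * Real.sin θ * Real.sin ((n + 1) * θ) := by
      rw [Real.cos_sub_cos, show ((n : ℝ) * θ + (n + 2) * θ) / 2 = (n + 1) * θ by ring,
        show ((n : ℝ) * θ - (n + 2) * θ) / 2 = -θ by ring, Real.sin_neg]
      ring
    simp only [Function.comp_apply]
    rw [e1, Real.sqrt_sq (by positivity), e2, e4]
    push_cast at e3
    rw [← e3]
    have e5 : (t : ℝ) = √(t : ℝ) * √(t : ℝ) := (Real.mul_self_sqrt t.coe_nonneg).symm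
    generalize √(t : ℝ) = σ at *
    rw [e5]
    field_simp
  rw [intervalIntegral.integral_congr h2, intervalIntegral.integral_const_mul,
    intervalIntegral.integral_sub (by apply Continuous.intervalIntegrable; fun_prop)
      (by apply Continuous.intervalIntegrable; fun_prop)]
  have h3 : ∀ m : ℕ, m ≠ 0 → ∫ θ in (0 : ℝ)..Real.pi, Real.cos (m * θ) = 0 := by
    intro m hm
    rw [intervalIntegral.integral_comp_mul_left (fun θ => Real.cos θ) (by exact_mod_cast hm)]
    simp
  have h4 := h3 (n + 2) (by omega)
  push_cast at h4
  rw [h3 n hn, h4]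
  simp

theorem IsLaw.map_aeval {A : Type*} [Ring A] [Algebra ℂ A] {φ : A →ₗ[ℂ] ℂ} {x : A} {μ : Measure ℝ}
    (h : IsLaw φ x μ) (p : Polynomial ℝ) (c : ℝ) :
    φ (Polynomial.aeval ((c : ℂ) • x) (p.map (algebraMap ℝ ℂ))) = (∫ s, p.eval (s * c) ∂μ : ℝ) := by
  obtain ⟨-, h⟩ := h
  rw [Polynomial.aeval_eq_sum_range, map_sum]
  simp only [Polynomial.eval_eq_sum_range, mul_pow]
  rw [integral_finsetSum _ fun i _ => (((h i).1.mul_const _).const_mul _), Complex.ofReal_sum]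
  rw [Polynomial.natDegree_map]
  refine Finset.sum_congr rfl fun i _ => ?_
  rw [integral_const_mul, integral_mul_const, smul_pow, map_smul, map_smul, (h i).2]
  simp [mul_comm]

theorem IsLaw.map_aeval_S {A : Type*} [Ring A] [Algebra ℂ A] {φ : A →ₗ[ℂ] ℂ} {x : A} {t : ℝ≥0}
    (ht : t ≠ 0) (h : IsLaw φ x (semicircular t)) {n : ℕ} (hn : n ≠ 0) :
    φ (Polynomial.aeval ((((√(t : ℝ))⁻¹ : ℝ) : ℂ) • x) (Polynomial.Chebyshev.S ℂ n)) = 0 := by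
  have := h.map_aeval (Polynomial.Chebyshev.S ℝ n) (√(t : ℝ))⁻¹
  simp only [← div_eq_mul_inv] at this
  rwa [integral_S_semicircular ht hn, Polynomial.Chebyshev.map_S, Complex.ofReal_zero] at this

end Semicircular

/-! ### Moments of the tetilla law -/

section Tetilla

/-- The words of the Fock space vector `x_i e_w`. -/
def letterActList (i : Fin 2) : List (Fin 2) → List (List (Fin 2))
  | [] => [[i]]
  | j :: w => (i :: j :: w) :: if i = j then [w] else []

/-- The words, with multiplicities, of the Fock space vector of `(x₀ x₁ + x₁ x₀) ^ m`. -/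
def anticommutatorWords : ℕ → List (List (Fin 2))
  | 0 => [[]]
  | m + 1 => (anticommutatorWords m).flatMap fun w =>
      (letterActList 1 w).flatMap (letterActList 0) ++ (letterActList 0 w).flatMap (letterActList 1)

variable {A : Type*} [Ring A] [Algebra ℂ A]

omit [Algebra ℂ A] in
theorem mul_wick_eq_sum (x : Fin 2 → A) (i : Fin 2) (w : List (Fin 2)) :
    x i * wick x w = ((letterActList i w).map (wick x)).sum := by
  rcases w with _ | ⟨j, w⟩
  · simp [letterActList, wick]
  · rw [mul_wick, letterActList]
    split_ifs <;> simp

omit [Algebra ℂ A] in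
theorem mul_sum_wick (x : Fin 2 → A) (i : Fin 2) (l : List (List (Fin 2))) :
    x i * (l.map (wick x)).sum = ((l.flatMap (letterActList i)).map (wick x)).sum := by
  induction l with
  | nil => simp
  | cons w l ih => simp [mul_add, ih, mul_wick_eq_sum]

omit [Algebra ℂ A] in
theorem anticommutator_pow (x : Fin 2 → A) (m : ℕ) :
    (x 0 * x 1 + x 1 * x 0) ^ m = ((anticommutatorWords m).map (wick x)).sum := by
  induction m with
  | zero => simp [anticommutatorWords, wick]
  | succ m ih =>
    rw [pow_succ', ih, anticommutatorWords]
    generalize anticommutatorWords m = l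
    induction l with
    | nil => simp
    | cons w l ih =>
      rw [List.map_cons, List.sum_cons, mul_add, ih, List.flatMap_cons, List.map_append,
        List.sum_append, List.map_append, List.sum_append, add_mul, mul_assoc, mul_assoc,
        mul_wick_eq_sum, mul_wick_eq_sum, mul_sum_wick, mul_sum_wick]

variable [StarRing A]

theorem IsSemicircularSystem.map_star_sum_wick_mul {φ : A →ₗ[ℂ] ℂ} {x : Fin 2 → A}
    (hx : IsSemicircularSystem φ x) (hsa : ∀ i, IsSelfAdjoint (x i)) (l l' : List (List (Fin 2))) :
    φ (star (l.map (wick x)).sum * (l'.map (wick x)).sum) =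
      ((l.map fun u => (l'.map fun v => if u = v then 1 else 0).sum).sum : ℕ) := by
  induction l with
  | nil => simp
  | cons u l ih =>
    rw [List.map_cons, List.sum_cons, star_add, add_mul, map_add, ih, List.map_cons, List.sum_cons,
      Nat.cast_add]
    congr 1
    clear ih
    induction l' with
    | nil => simp
    | cons v l' ih =>
      rw [List.map_cons, List.sum_cons, mul_add, map_add, ih, List.map_cons, List.sum_cons,
        Nat.cast_add, hx.map_star_wick_mul_wick hsa]
      simp

set_option maxRecDepth 10000 in
theorem anticommutator_moments {φ : A →ₗ[ℂ] ℂ} {x : Fin 2 → A}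
    (hx : IsSemicircularSystem φ x) (hsa : ∀ i, IsSelfAdjoint (x i)) :
    φ ((x 0 * x 1 + x 1 * x 0) ^ 2) = 2 ∧ φ ((x 0 * x 1 + x 1 * x 0) ^ 4) = 10 ∧
      φ ((x 0 * x 1 + x 1 * x 0) ^ 6) = 66 := by
  have hU : star (x 0 * x 1 + x 1 * x 0) = x 0 * x 1 + x 1 * x 0 := by
    simp [(hsa _).star_eq, add_comm]
  have key : ∀ m c : ℕ, (((anticommutatorWords m).map fun u =>
      ((anticommutatorWords m).map fun v => if u = v then 1 else 0).sum).sum) = c →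
      φ ((x 0 * x 1 + x 1 * x 0) ^ (m + m)) = c := by
    rintro m c rfl
    rw [← hx.map_star_sum_wick_mul hsa, ← anticommutator_pow, star_pow, hU, pow_add]
  refine ⟨?_, ?_, ?_⟩
  · exact_mod_cast key 1 2 (by decide)
  · exact_mod_cast key 2 10 (by decide)
  · exact_mod_cast key 3 66 (by decide)

theorem tetilla_moments {φ : A →ₗ[ℂ] ℂ} (h1 : φ 1 = 1) {x y : A} (hx : IsSelfAdjoint x)
    (hy : IsSelfAdjoint y) (hlx : IsLaw φ x (semicircular 1)) (hly : IsLaw φ y (semicircular 1))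
    (hfree : FreelyIndependent φ ![Algebra.adjoin ℂ {x}, Algebra.adjoin ℂ {y}]) :
    φ ((((√2 : ℝ) : ℂ)⁻¹ • (x * y + y * x)) ^ 2) = 1 ∧
    φ ((((√2 : ℝ) : ℂ)⁻¹ • (x * y + y * x)) ^ 4) = 5 / 2 ∧
    φ ((((√2 : ℝ) : ℂ)⁻¹ • (x * y + y * x)) ^ 6) = 33 / 4 := by
  have hbot : FreelyIndependent φ ![Algebra.adjoin ℂ {y}, ⊥] := by
    intro m i z hi hz hz0
    have hone : ∀ j, i j = 1 → z j = 0 := by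
      intro j hj
      have h := hz j
      rw [hj] at h
      obtain ⟨c, hc⟩ := Algebra.mem_bot.1 (by simpa using h)
      have h0 := hz0 j
      rw [← hc, Algebra.algebraMap_eq_smul_one, map_smul, h1, smul_eq_mul, mul_one] at h0
      rw [← hc, h0, map_zero]
    by_cases h : ∃ j, i j = 1
    · obtain ⟨j, hj⟩ := h
      rw [List.prod_eq_zero (List.mem_ofFn.2 ⟨j, hone j hj⟩), map_zero]
    · push Not at h
      have h' : ∀ j, i j = 0 := by
        intro j
        have := h j
        generalize i j = a at this
        fin_cases a
        · rfl
        · exact absurd rfl this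
      rcases m with _ | m
      · simpa using hz0 0
      · exact absurd ((h' _).trans (h' _).symm) (hi 0)
  have hS : ∀ z : A, IsLaw φ z (semicircular 1) → ∀ n : ℕ, n ≠ 0 →
      φ (Polynomial.aeval z (Polynomial.Chebyshev.S ℂ n)) = 0 := by
    intro z hz n hn
    simpa using hz.map_aeval_S one_ne_zero hn
  have hsys : IsSemicircularSystem φ ![y, x] := by
    refine isSemicircularSystem_of_free h1 ![y, x] ![⊥, Algebra.adjoin ℂ {y}] ?_ ?_ ?_
    · intro i j hij
      fin_cases i <;> fin_cases j <;> simp at hij ⊢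
    · intro i
      fin_cases i
      · exact hbot
      · exact hfree
    · intro i n hn
      fin_cases i
      · exact hS y hly n hn
      · exact hS x hlx n hn
  have hsa : ∀ i, IsSelfAdjoint ((![y, x] : Fin 2 → A) i) := by
    intro i
    fin_cases i
    · exact hy
    · exact hx
  obtain ⟨m2, m4, m6⟩ := anticommutator_moments hsys hsa
  simp only [Matrix.cons_val_zero, Matrix.cons_val_one, add_comm (y * x)] at m2 m4 m6
  have hs : (((√2 : ℝ) : ℂ)⁻¹) ^ 2 = 2⁻¹ := by
    rw [inv_pow, ← Complex.ofReal_pow, Real.sq_sqrt (by norm_num)]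
    norm_num
  refine ⟨?_, ?_, ?_⟩
  · rw [smul_pow, map_smul, m2, hs]
    norm_num
  · rw [smul_pow, map_smul, m4, pow_mul _ 2 2, hs]
    norm_num
  · rw [smul_pow, map_smul, m6, pow_mul _ 2 3, hs]
    norm_num

end Tetilla

/-! ### Norm estimates in a tracial `W*`-probability space -/

namespace WStarProbabilitySpace

variable {H : Type*} [NormedAddCommGroup H] [InnerProductSpace ℂ H] [CompleteSpace H]

theorem isClosed_algebra (P : WStarProbabilitySpace H) :
    IsClosed (P.algebra.toStarSubalgebra : Set (H →L[ℂ] H)) := by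
  rw [VonNeumannAlgebra.coe_toStarSubalgebra, ← VonNeumannAlgebra.centralizer_centralizer]
  exact Set.isClosed_centralizer _

/-- The `C*`-algebra structure of `𝒜`. -/
noncomputable abbrev cstarAlgebra (P : WStarProbabilitySpace H) : CStarAlgebra P.Elem :=
  haveI := P.isClosed_algebra
  StarSubalgebra.cstarAlgebra P.algebra.toStarSubalgebra

variable (P : WStarProbabilitySpace H)

theorem tendsto_E {α : Type*} {l : Filter α} {x : α → P.Elem} {a : P.Elem}
    (h : Tendsto x l (𝓝 a)) : Tendsto (fun n => P.E (x n)) l (𝓝 (P.E a)) := by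
  refine (P.weakly_continuous (‖a‖ + 1) (𝓝 a) a ?_ ?_).comp h
  · exact (continuous_norm.tendsto a).eventually (Iic_mem_nhds (lt_add_one _))
  · intro u v
    have : Continuous fun x : P.Elem => inner ℂ u ((x : H →L[ℂ] H) v) := by fun_prop
    exact this.tendsto a

theorem E_star_mul_self_nonneg (x : P.Elem) : 0 ≤ P.E (star x * x) := by
  rw [P.tracial]
  exact P.positive x

theorem E_star_mul_self_eq (x : P.Elem) : P.E (star x * x) = ((P.l2Norm x ^ 2 : ℝ) : ℂ) := by
  have h := Complex.nonneg_iff.1 (P.E_star_mul_self_nonneg x)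
  rw [l2Norm, Real.sq_sqrt h.1]
  exact Complex.ext rfl (by simp [← h.2])

theorem l2Norm_nonneg (x : P.Elem) : 0 ≤ P.l2Norm x := Real.sqrt_nonneg _

theorem eq_zero_of_l2Norm {x : P.Elem} (h : P.l2Norm x = 0) : x = 0 := by
  apply P.faithful
  rw [← P.tracial, E_star_mul_self_eq, h]
  simp

theorem l2Norm_sq_add_le (x y : P.Elem) :
    P.l2Norm (x + y) ^ 2 ≤ 2 * P.l2Norm x ^ 2 + 2 * P.l2Norm y ^ 2 := by
  have h : P.E (star (x + y) * (x + y)) + P.E (star (x - y) * (x - y)) =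
      2 * P.E (star x * x) + 2 * P.E (star y * y) := by
    have e : star (x + y) * (x + y) + star (x - y) * (x - y) =
        (2 : ℂ) • (star x * x) + (2 : ℂ) • (star y * y) := by
      rw [star_add, star_sub, two_smul, two_smul]
      noncomm_ring
    rw [← map_add, e, map_add, map_smul, map_smul, smul_eq_mul, smul_eq_mul]
  simp only [E_star_mul_self_eq] at h
  have h' : P.l2Norm (x + y) ^ 2 + P.l2Norm (x - y) ^ 2 =
      2 * P.l2Norm x ^ 2 + 2 * P.l2Norm y ^ 2 := by exact_mod_cast h
  nlinarith [sq_nonneg (P.l2Norm (x - y))]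

theorem tendsto_l2Norm_sub {α : Type*} {l : Filter α} {x : α → P.Elem} {a : P.Elem}
    (h : Tendsto x l (𝓝 a)) : Tendsto (fun n => P.l2Norm (x n - a)) l (𝓝 0) := by
  have h1 : Tendsto (fun n => x n - a) l (𝓝 0) := by simpa using h.sub_const a
  have h2 := P.tendsto_E (h1.star.mul h1)
  simp only [star_zero, mul_zero, map_zero] at h2
  have h3 := ((Complex.continuous_re.tendsto _).comp h2).sqrt
  simpa [l2Norm] using h3

section

attribute [local instance] cstarAlgebra

theorem E_cfc_nonneg {a : P.Elem} {g : ℝ → ℝ} (hg : Continuous g)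
    (h0 : ∀ t ∈ spectrum ℝ a, 0 ≤ g t) : 0 ≤ (P.E (cfc g a)).re := by
  have h : cfc g a = cfc (fun t => √(g t)) a * star (cfc (fun t => √(g t)) a) := by
    rw [← cfc_star, ← cfc_mul _ _ a (by fun_prop) (by fun_prop)]
    refine cfc_congr fun t ht => ?_
    simp [Real.mul_self_sqrt (h0 t ht)]
  rw [h]
  exact (Complex.nonneg_iff.1 (P.positive _)).1

end

theorem norm_le_of_moments {a : P.Elem} (ha : IsSelfAdjoint a) {C : ℝ} (hC : 0 ≤ C)
    (h : ∀ m : ℕ, (P.E (a ^ (2 * m))).re ≤ (C ^ 2) ^ m) : ‖a‖ ≤ C := by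
  let _ := P.cstarAlgebra
  refine le_of_forall_gt_imp_ge_of_dense fun D hD => ?_
  have hD0 : 0 < D := hC.trans_lt hD
  set g : ℝ → ℝ := fun t => max (|t| - D) 0 with hg
  have hgc : Continuous g := by fun_prop
  have hbound : ∀ m : ℕ, ∀ t ∈ spectrum ℝ a,
      0 ≤ ‖a‖ ^ 2 * (D ^ 2)⁻¹ ^ m * t ^ (2 * m) - g t * g t := by
    intro m t ht
    have h1 : |t| ≤ ‖a‖ := by
      have h2 := (norm_cfc_le_iff id a (norm_nonneg a)).1 (by rw [cfc_id ℝ a]) t ht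
      simpa using h2
    rcases le_or_gt |t| D with h2 | h2
    · have : g t = 0 := by simp [hg, h2]
      rw [this, mul_zero, sub_zero, pow_mul]
      positivity
    · have h3 : g t = |t| - D := by simp [hg, h2.le]
      have h4 : 1 ≤ (D ^ 2)⁻¹ ^ m * t ^ (2 * m) := by
        rw [pow_mul, ← mul_pow]
        refine one_le_pow₀ ?_
        rw [inv_mul_eq_div, one_le_div (by positivity), ← sq_abs t]
        exact pow_le_pow_left₀ hD0.le h2.le 2
      have h5 : g t * g t ≤ ‖a‖ ^ 2 := by
        rw [h3, ← sq]
        exact pow_le_pow_left₀ (by linarith) (by linarith) 2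
      nlinarith [sq_nonneg ‖a‖]
  have hE : ∀ m : ℕ, (P.E (cfc g a * cfc g a)).re ≤ ‖a‖ ^ 2 * (C ^ 2 / D ^ 2) ^ m := by
    intro m
    have h1 := P.E_cfc_nonneg (by fun_prop) (hbound m)
    rw [cfc_sub (fun t => ‖a‖ ^ 2 * (D ^ 2)⁻¹ ^ m * t ^ (2 * m)) (fun t => g t * g t) a (by fun_prop)
      (by fun_prop), cfc_const_mul _ _ a (by fun_prop), cfc_mul _ _ a (by fun_prop) (by fun_prop),
      cfc_pow_id a _, map_sub, LinearMap.map_smul_of_tower, Complex.sub_re, Complex.real_smul,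
      Complex.re_ofReal_mul] at h1
    calc _ ≤ ‖a‖ ^ 2 * (D ^ 2)⁻¹ ^ m * (P.E (a ^ (2 * m))).re := by linarith
      _ ≤ ‖a‖ ^ 2 * (D ^ 2)⁻¹ ^ m * (C ^ 2) ^ m := by gcongr; exact h m
      _ = _ := by rw [div_eq_mul_inv, mul_pow]; ring
  have hlim : Tendsto (fun m : ℕ => ‖a‖ ^ 2 * (C ^ 2 / D ^ 2) ^ m) atTop (𝓝 0) := by
    have h1 : C ^ 2 / D ^ 2 < 1 := by
      rw [div_lt_one (by positivity)]
      exact pow_lt_pow_left₀ hD hC two_ne_zero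
    simpa using (tendsto_pow_atTop_nhds_zero_of_lt_one (by positivity) h1).const_mul (‖a‖ ^ 2)
  have hle : (P.E (cfc g a * cfc g a)).re ≤ 0 := ge_of_tendsto' hlim hE
  have hsa : star (cfc g a) = cfc g a := (cfc_predicate g a).star_eq
  have hzero : cfc g a = 0 := by
    apply P.faithful
    have h1 := Complex.nonneg_iff.1 (P.positive (cfc g a))
    rw [hsa] at h1 ⊢
    exact Complex.ext (le_antisymm hle h1.1) h1.2.symm
  have hspec : ∀ t ∈ spectrum ℝ a, ‖t‖ ≤ D := by
    intro t ht
    have h1 : ‖cfc g a‖ ≤ 0 := by rw [hzero, norm_zero]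
    have h2 := (norm_cfc_le_iff g a le_rfl).1 h1 t ht
    have h3 : g t = 0 := by simpa using h2
    simpa [hg] using h3
  have := (norm_cfc_le_iff id a hD0.le).2 hspec
  rwa [cfc_id ℝ a] at this

end WStarProbabilitySpace

/-! ### Product tensors -/

section Tensor

variable {ι : Type*}

/-- The product tensor `g₁ ⊗ ⋯ ⊗ gₙ`, as a function on words. -/
def productTensor : List (ι → ℝ) → List ι → ℝ
  | [], [] => 1
  | g :: gs, i :: w => g i * productTensor gs w
  | [], _ :: _ => 0
  | _ :: _, [] => 0

theorem length_eq_of_productTensor : ∀ (gs : List (ι → ℝ)) (w : List ι),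
    productTensor gs w ≠ 0 → w.length = gs.length
  | [], [], _ => rfl
  | g :: gs, i :: w, h => by
    rw [List.length_cons, List.length_cons,
      length_eq_of_productTensor gs w (right_ne_zero_of_mul h)]
  | [], _ :: _, h => absurd rfl h
  | _ :: _, [], h => absurd rfl h

theorem productTensor_append : ∀ (gs gs' : List (ι → ℝ)) (u v : List ι),
    u.length = gs.length → productTensor (gs ++ gs') (u ++ v) =
      productTensor gs u * productTensor gs' v
  | [], gs', [], v, _ => by simp [productTensor]
  | g :: gs, gs', i :: u, v, h => by
    have := productTensor_append gs gs' u v (by simpa using h)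
    simp [productTensor, this, mul_assoc]
  | [], _, _ :: _, _, h => by simp at h
  | _ :: _, _, [], _, h => by simp at h

theorem productTensor_reverse (gs : List (ι → ℝ)) (w : List ι) :
    productTensor gs.reverse w.reverse = productTensor gs w := by
  by_cases h : w.length = gs.length
  · induction gs generalizing w with
    | nil =>
      have : w = [] := by simpa using h
      simp [this]
    | cons g gs ih =>
      rcases w with _ | ⟨i, w⟩
      · simp at h
      · have h' : w.length = gs.length := by simpa using h
        rw [List.reverse_cons, List.reverse_cons, productTensor_append _ _ _ _ (by simpa using h'),
          ih w h']
        simp [productTensor, mul_comm]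
  · rw [not_imp_comm.1 (length_eq_of_productTensor gs w) h,
      not_imp_comm.1 (length_eq_of_productTensor gs.reverse w.reverse) (by simpa using h)]

theorem isChain_of_productTensor : ∀ (gs : List (ι → ℝ)) (w : List ι),
    (gs.IsChain fun g g' => ∀ i, g i = 0 ∨ g' i = 0) → productTensor gs w ≠ 0 →
    w.IsChain (· ≠ ·)
  | _, [], _, _ => by simp
  | _, [i], _, _ => by simp
  | [], _ :: _, _, h => absurd rfl h
  | [_], _ :: _ :: _, _, h => absurd (by simp [productTensor]) h
  | g :: g' :: gs, i :: j :: w, hc, h => by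
    rw [List.isChain_cons_cons] at hc
    have h1 : productTensor (g' :: gs) (j :: w) ≠ 0 := right_ne_zero_of_mul h
    refine List.isChain_cons_cons.2 ⟨?_, isChain_of_productTensor _ _ hc.2 h1⟩
    rintro rfl
    rcases hc.1 i with h0 | h0
    · exact left_ne_zero_of_mul h h0
    · exact left_ne_zero_of_mul h1 h0

variable [Fintype ι]

theorem sum_productTensor_mul : ∀ {n : ℕ} (G G' : Fin n → ι → ℝ),
    ∑ w ∈ words ι n, productTensor (List.ofFn G) w * productTensor (List.ofFn G') w =
      ∏ k, ∑ i, G k i * G' k i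
  | 0, G, G' => by simp [productTensor]
  | n + 1, G, G' => by
    rw [sum_words_succ, Fin.prod_univ_succ, ← sum_productTensor_mul, Finset.sum_mul_sum]
    refine Finset.sum_congr rfl fun i _ => Finset.sum_congr rfl fun w _ => ?_
    rw [List.ofFn_succ, List.ofFn_succ, productTensor, productTensor]
    ring

variable {A : Type*} [Ring A] [Algebra ℂ A]

theorem prod_ofFn_sum_eq_wordSum (x : ι → A) : ∀ {n : ℕ} (G : Fin n → ι → ℝ),
    (List.ofFn fun k => ∑ i, G k i • x i).prod = wordSum x n (productTensor (List.ofFn G))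
  | 0, G => by simp [wordSum, productTensor]
  | n + 1, G => by
    rw [List.ofFn_succ, List.prod_cons, prod_ofFn_sum_eq_wordSum x fun k => G k.succ, wordSum,
      wordSum, sum_words_succ, Finset.sum_mul_sum]
    refine Finset.sum_congr rfl fun i _ => Finset.sum_congr rfl fun w _ => ?_
    rw [List.ofFn_succ, productTensor, List.map_cons, List.prod_cons, smul_mul_smul_comm]

variable [DecidableEq ι]

omit [Fintype ι] [Algebra ℂ A] in
theorem map_prod_eq_wick (x : ι → A) : ∀ u : List ι, u.IsChain (· ≠ ·) → (u.map x).prod = wick x u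
  | [], _ => by simp [wick]
  | [i], _ => by simp [wick]
  | i :: j :: u, h => by
    have h' := List.isChain_cons_cons.1 h
    rw [List.map_cons, List.prod_cons, map_prod_eq_wick x (j :: u) h'.2, wick, if_neg h'.1,
      sub_zero]

variable [StarRing A] [StarModule ℂ A]

theorem IsSemicircularSystem.map_star_wordSum_mul {φ : A →ₗ[ℂ] ℂ} {x : ι → A}
    (hx : IsSemicircularSystem φ x) (hsa : ∀ i, IsSelfAdjoint (x i)) {q : ℕ} {f g : List ι → ℝ}
    (hf : ∀ u, f u ≠ 0 → u.IsChain (· ≠ ·)) (hg : ∀ u, g u ≠ 0 → u.IsChain (· ≠ ·)) :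
    φ (star (wordSum x q f) * wordSum x q g) = ((∑ w ∈ words ι q, f w * g w : ℝ) : ℂ) := by
  have h : ∀ f : List ι → ℝ, (∀ u, f u ≠ 0 → u.IsChain (· ≠ ·)) →
      wordSum x q f = ∑ u ∈ words ι q, f u • wick x u := by
    intro f hf
    refine Finset.sum_congr rfl fun u _ => ?_
    by_cases h0 : f u = 0
    · simp [h0]
    · rw [map_prod_eq_wick x u (hf u h0)]
  rw [h f hf, h g hg, star_sum, Finset.sum_mul_sum, map_sum, Complex.ofReal_sum]
  refine Finset.sum_congr rfl fun u hu => ?_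
  rw [map_sum, Finset.sum_eq_single u]
  · rw [star_smul, smul_mul_smul_comm, LinearMap.map_smul_of_tower, hx.map_star_wick_mul_wick hsa]
    simp
  · intro v _ hvu
    rw [star_smul, smul_mul_smul_comm, LinearMap.map_smul_of_tower, hx.map_star_wick_mul_wick hsa,
      if_neg hvu.symm, smul_zero]
  · exact fun h => absurd hu h

end Tensor

/-! ### Increments of the free Brownian motion along a grid -/

section Grid

variable {H : Type*} [NormedAddCommGroup H] [InnerProductSpace ℂ H] [CompleteSpace H]
  {P : WStarProbabilitySpace H} (W : FreeBrownianMotion P)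

/-- The normalized increments of the free Brownian motion along the grid `t`. -/
noncomputable def FreeBrownianMotion.gridIncrement (t : ℕ → ℝ≥0) (N : ℕ) (j : Fin N) : P.Elem :=
  (((√((t (j + 1) - t j : ℝ≥0) : ℝ))⁻¹ : ℝ) : ℂ) • (W.S (t (j + 1)) - W.S (t j))

/-- The coordinates of the increment over `(a, b)`. -/
noncomputable def gridCoord (t : ℕ → ℝ≥0) (N : ℕ) (a b : ℝ≥0) (j : Fin N) : ℝ :=
  if a ≤ t j ∧ t (j + 1) ≤ b then √((t (j + 1) - t j : ℝ≥0) : ℝ) else 0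

theorem FreelyIndependent.mono {A : Type*} [Ring A] [Algebra ℂ A] {φ : A →ₗ[ℂ] ℂ} {κ : Type*}
    {B B' : κ → Subalgebra ℂ A} (h : FreelyIndependent φ B) (hB : ∀ i, B' i ≤ B i) :
    FreelyIndependent φ B' :=
  fun m i x hi hx h0 => h m i x hi (fun j => hB _ (hx j)) h0

theorem WStarProbabilitySpace.mem_subalgebraOf {N : VonNeumannAlgebra H} {x : P.Elem} :
    x ∈ P.subalgebraOf N ↔ (x : H →L[ℂ] H) ∈ N := Iff.rfl

theorem FreeBrownianMotion.isSemicircularSystem {t : ℕ → ℝ≥0} (ht : StrictMono t) (N : ℕ) :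
    IsSemicircularSystem P.E (W.gridIncrement t N) := by
  have h1 : ∀ i j : Fin N, i < j →
      W.gridIncrement t N i ∈ P.subalgebraOf (W.filtration (t j)) := by
    intro i j hij
    refine Subalgebra.smul_mem _ (Subalgebra.sub_mem _ ?_ ?_) _
    · rw [WStarProbabilitySpace.mem_subalgebraOf]
      exact W.filtration_mono (ht.monotone (Nat.succ_le_of_lt hij)) (W.adapted _)
    · rw [WStarProbabilitySpace.mem_subalgebraOf]
      exact W.filtration_mono (ht.monotone hij.le) (W.adapted _)
  have h2 : ∀ j : Fin N, FreelyIndependent P.E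
      ![Algebra.adjoin ℂ {W.gridIncrement t N j}, P.subalgebraOf (W.filtration (t j))] := by
    intro j
    have h3 := W.free_increment (t j) (t (j + 1)) (ht (Nat.lt_succ_self _))
    rw [WStarProbabilitySpace.FreeFrom] at h3
    refine h3.mono (Fin.forall_fin_two.2 ⟨?_, ?_⟩)
    swap
    · rw [Matrix.cons_val_one, Matrix.cons_val_one]
    rw [Matrix.cons_val_zero, Matrix.cons_val_zero]
    refine Algebra.adjoin_le (Set.singleton_subset_iff.2 ?_)
    exact Subalgebra.smul_mem _ (Algebra.self_mem_adjoin_singleton ℂ _) _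
  have h3 : ∀ (j : Fin N) (n : ℕ), n ≠ 0 → P.E (Polynomial.aeval (W.gridIncrement t N j)
      (Polynomial.Chebyshev.S ℂ n)) = 0 := by
    intro j n hn
    have hlt := ht (Nat.lt_succ_self j.1)
    exact (W.law_increment _ _ hlt).map_aeval_S (tsub_pos_of_lt hlt).ne' hn
  exact isSemicircularSystem_of_free P.map_one _ _ h1 h2 h3

theorem FreeBrownianMotion.isSelfAdjoint_gridIncrement (t : ℕ → ℝ≥0) (N : ℕ) (j : Fin N) :
    IsSelfAdjoint (W.gridIncrement t N j) := by
  refine IsSelfAdjoint.smul ?_ ((W.selfAdjoint _).sub (W.selfAdjoint _))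
  exact Complex.conj_ofReal _

theorem gridCoord_apply {t : ℕ → ℝ≥0} (ht : StrictMono t) {N : ℕ} (α β : ℕ) (j : Fin N) :
    gridCoord t N (t α) (t β) j =
      if j.1 ∈ Finset.Ico α β then √((t (j + 1) - t j : ℝ≥0) : ℝ) else 0 := by
  simp only [gridCoord, ht.le_iff_le, Finset.mem_Ico, Nat.succ_le_iff]

theorem FreeBrownianMotion.sum_gridCoord_smul {t : ℕ → ℝ≥0} (ht : StrictMono t) {N α β : ℕ}
    (hαβ : α ≤ β) (hβ : β ≤ N) :
    ∑ j, gridCoord t N (t α) (t β) j • W.gridIncrement t N j = W.S (t β) - W.S (t α) := by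
  have h1 : ∀ j : Fin N, gridCoord t N (t α) (t β) j • W.gridIncrement t N j =
      if j.1 ∈ Finset.Ico α β then W.S (t (j.1 + 1)) - W.S (t j.1) else 0 := by
    intro j
    rw [gridCoord_apply ht]
    split_ifs
    · have h2 : √((t (j + 1) - t j : ℝ≥0) : ℝ) ≠ 0 :=
        (Real.sqrt_pos.2 (NNReal.coe_pos.2 (tsub_pos_of_lt (ht (Nat.lt_succ_self _))))).ne'
      rw [FreeBrownianMotion.gridIncrement, ← Complex.coe_smul, smul_smul, ← Complex.ofReal_mul,
        mul_inv_cancel₀ h2, Complex.ofReal_one, one_smul]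
    · rw [zero_smul]
  rw [Finset.sum_congr rfl fun j _ => h1 j,
    Fin.sum_univ_eq_sum_range (fun j => if j ∈ Finset.Ico α β then W.S (t (j + 1)) - W.S (t j) else 0)
      N, Finset.sum_ite_mem, Finset.inter_eq_right.2, Finset.sum_Ico_sub (fun j => W.S (t j)) hαβ]
  intro j hj
  rw [Finset.mem_Ico] at hj
  exact Finset.mem_range.2 (by omega)

theorem sum_gridCoord_mul {t : ℕ → ℝ≥0} (ht : StrictMono t) {N α β α' β' : ℕ} (hβ : β ≤ N) :
    ∑ j, gridCoord t N (t α) (t β) j * gridCoord t N (t α') (t β') j =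
      max 0 (min (t β : ℝ) (t β') - max (t α : ℝ) (t α')) := by
  have h1 : ∀ j : Fin N, gridCoord t N (t α) (t β) j * gridCoord t N (t α') (t β') j =
      if j.1 ∈ Finset.Ico (max α α') (min β β') then (t (j.1 + 1) : ℝ) - t j.1 else 0 := by
    intro j
    have h3 := (ht (Nat.lt_succ_self j.1)).le
    rw [gridCoord_apply ht, gridCoord_apply ht, ← Finset.Ico_inter_Ico]
    simp only [Finset.mem_inter]
    by_cases h4 : j.1 ∈ Finset.Ico α β <;> by_cases h5 : j.1 ∈ Finset.Ico α' β' <;> simp only [h4, h5,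
      if_true, if_false, and_true, and_false, mul_zero, zero_mul]
    rw [Real.mul_self_sqrt (NNReal.coe_nonneg _), NNReal.coe_sub h3]
  have hm : Monotone fun n => (t n : ℝ) := fun a b h => NNReal.coe_le_coe.2 (ht.monotone h)
  rw [Finset.sum_congr rfl fun j _ => h1 j,
    Fin.sum_univ_eq_sum_range (fun j => if j ∈ Finset.Ico (max α α') (min β β') then
      (t (j + 1) : ℝ) - t j else 0) N, Finset.sum_ite_mem, Finset.inter_eq_right.2]
  · rw [← hm.map_min, ← hm.map_max]
    rcases le_total (max α α') (min β β') with h | h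
    · rw [Finset.sum_Ico_sub (fun j => (t j : ℝ)) h, max_eq_right (sub_nonneg.2 (hm h))]
    · rw [Finset.Ico_eq_empty_of_le h, Finset.sum_empty, max_eq_left (sub_nonpos.2 (hm h))]
  · intro j hj
    rw [Finset.mem_Ico, lt_min_iff] at hj
    exact Finset.mem_range.2 (by omega)

theorem exists_grid (s : Finset ℝ≥0) : ∃ (t : ℕ → ℝ≥0) (N : ℕ), StrictMono t ∧
    ∀ a ∈ s, ∃ n ≤ N, t n = a := by
  refine ⟨fun n => if h : n < s.card then s.orderEmbOfFin rfl ⟨n, h⟩ else s.sup id + 1 + n, s.card,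
    ?_, ?_⟩
  · intro m n hmn
    dsimp only
    by_cases hn : n < s.card
    · rw [dif_pos hn, dif_pos (hmn.trans hn)]
      exact (s.orderEmbOfFin rfl).strictMono hmn
    · rw [dif_neg hn]
      split_ifs with hm
      · calc s.orderEmbOfFin rfl ⟨m, hm⟩ ≤ s.sup id :=
              Finset.le_sup (f := id) (s.orderEmbOfFin_mem rfl _)
          _ < s.sup id + 1 := lt_add_one _
          _ ≤ s.sup id + 1 + n := le_self_add
      · gcongr
  · intro a ha
    have : a ∈ Set.range (s.orderEmbOfFin rfl) := by rwa [s.range_orderEmbOfFin rfl]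
    obtain ⟨n, rfl⟩ := this
    exact ⟨n, n.2.le, by simp⟩

/-- The end points of the intervals of a box. -/
noncomputable def OffDiagonalBox.endPoints {q : ℕ} (B : OffDiagonalBox q) : Finset ℝ≥0 :=
  Finset.univ.image B.a ∪ Finset.univ.image B.b

/-- The coordinates of a box along a grid. -/
noncomputable def OffDiagonalBox.coord {q : ℕ} (B : OffDiagonalBox q) (t : ℕ → ℝ≥0) (N : ℕ)
    (i : Fin q) : Fin N → ℝ :=
  gridCoord t N (B.a i) (B.b i)

/-- The kernel of a simple function along a grid. -/
noncomputable def simpleKernel {q : ℕ} (t : ℕ → ℝ≥0) (N : ℕ) (s : OffDiagonalBox q →₀ ℝ)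
    (w : List (Fin N)) : ℝ :=
  s.sum fun B c => c * productTensor (List.ofFn (B.coord t N)) w

/-- The grid `t` of length `N` contains the end points of all boxes which occur in `s`. -/
def IsGridFor {q : ℕ} (t : ℕ → ℝ≥0) (N : ℕ) (s : OffDiagonalBox q →₀ ℝ) : Prop :=
  StrictMono t ∧ ∀ B ∈ s.support, ∀ i, (∃ n ≤ N, t n = B.a i) ∧ ∃ n ≤ N, t n = B.b i

theorem exists_isGridFor {q : ℕ} (s s' : OffDiagonalBox q →₀ ℝ) :
    ∃ t N, IsGridFor t N s ∧ IsGridFor t N s' := by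
  classical
  obtain ⟨t, N, ht, h⟩ := exists_grid
    (s.support.biUnion OffDiagonalBox.endPoints ∪ s'.support.biUnion OffDiagonalBox.endPoints)
  refine ⟨t, N, ⟨ht, fun B hB i => ⟨h _ ?_, h _ ?_⟩⟩, ht, fun B hB i => ⟨h _ ?_, h _ ?_⟩⟩
  · exact Finset.mem_union_left _ (Finset.mem_biUnion.2 ⟨B, hB, by simp [OffDiagonalBox.endPoints]⟩)
  · exact Finset.mem_union_left _ (Finset.mem_biUnion.2 ⟨B, hB, by simp [OffDiagonalBox.endPoints]⟩)
  · exact Finset.mem_union_right _ (Finset.mem_biUnion.2 ⟨B, hB, by simp [OffDiagonalBox.endPoints]⟩)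
  · exact Finset.mem_union_right _ (Finset.mem_biUnion.2 ⟨B, hB, by simp [OffDiagonalBox.endPoints]⟩)

variable {q : ℕ} {t : ℕ → ℝ≥0} {N : ℕ} {s s' : OffDiagonalBox q →₀ ℝ}

theorem IsGridFor.integral_eq (hs : IsGridFor t N s) {B : OffDiagonalBox q} (hB : B ∈ s.support) :
    B.integral W = wordSum (W.gridIncrement t N) q (productTensor (List.ofFn (B.coord t N))) := by
  rw [← prod_ofFn_sum_eq_wordSum, OffDiagonalBox.integral]
  congr 2
  funext i
  obtain ⟨⟨α, hα, hα'⟩, β, hβ, hβ'⟩ := hs.2 B hB i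
  have hlt := B.lt i
  rw [← hα', ← hβ', hs.1.lt_iff_lt] at hlt
  rw [OffDiagonalBox.coord, ← hα', ← hβ', W.sum_gridCoord_smul hs.1 hlt.le hβ]

theorem IsGridFor.simpleIntegral_eq (hs : IsGridFor t N s) :
    simpleIntegral W s = wordSum (W.gridIncrement t N) q (simpleKernel t N s) := by
  rw [simpleIntegral, wordSum]
  simp only [simpleKernel, Finsupp.sum, Finset.sum_smul]
  rw [Finset.sum_comm]
  refine Finset.sum_congr rfl fun B hB => ?_
  rw [hs.integral_eq W hB, wordSum, Finset.smul_sum]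
  refine Finset.sum_congr rfl fun w _ => ?_
  rw [mul_smul, Complex.coe_smul]

theorem OffDiagonalBox.isChain_coord (B : OffDiagonalBox q) (t : ℕ → ℝ≥0) (ht : StrictMono t)
    (N : ℕ) : (List.ofFn (B.coord t N)).IsChain fun g g' => ∀ j, g j = 0 ∨ g' j = 0 := by
  rw [List.isChain_iff_getElem]
  intro i hi j
  rw [List.length_ofFn] at hi
  rw [List.getElem_ofFn, List.getElem_ofFn]
  by_contra! h
  obtain ⟨h1, h2⟩ := h
  simp only [OffDiagonalBox.coord, gridCoord, ne_eq, ite_eq_right_iff, Classical.not_imp] at h1 h2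
  have hdis := B.disjoint ⟨i, by omega⟩ ⟨i + 1, hi⟩ (by simp)
  obtain ⟨m, hm1, hm2⟩ := exists_between (ht (Nat.lt_succ_self j.1))
  exact Set.disjoint_left.1 hdis ⟨h1.1.1.trans_lt hm1, hm2.trans_le h1.1.2⟩
    ⟨h2.1.1.trans_lt hm1, hm2.trans_le h2.1.2⟩

theorem simpleKernel_isChain (ht : StrictMono t) (s : OffDiagonalBox q →₀ ℝ) (w : List (Fin N))
    (h : simpleKernel t N s w ≠ 0) : w.IsChain (· ≠ ·) := by
  obtain ⟨B, _, hB⟩ := Finset.exists_ne_zero_of_sum_ne_zero h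
  exact isChain_of_productTensor _ w (B.isChain_coord t ht N) (right_ne_zero_of_mul hB)

theorem simpleKernel_length (s : OffDiagonalBox q →₀ ℝ) (w : List (Fin N))
    (h : simpleKernel t N s w ≠ 0) : w.length = q := by
  obtain ⟨B, _, hB⟩ := Finset.exists_ne_zero_of_sum_ne_zero h
  simpa using length_eq_of_productTensor _ w (right_ne_zero_of_mul hB)

/-- The inner product in `L²(ℝ₊^q)` of the indicators of two boxes. -/
noncomputable def OffDiagonalBox.inner (B B' : OffDiagonalBox q) : ℝ :=
  ∏ i, max 0 (min (B.b i : ℝ) (B'.b i) - max (B.a i : ℝ) (B'.a i))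

theorem sum_simpleKernel_mul (hs : IsGridFor t N s) (hs' : IsGridFor t N s') :
    ∑ w ∈ words (Fin N) q, simpleKernel t N s w * simpleKernel t N s' w =
      s.sum fun B c => s'.sum fun B' c' => c * c' * B.inner B' := by
  simp only [simpleKernel, Finsupp.sum, Finset.sum_mul_sum]
  rw [Finset.sum_comm]
  refine Finset.sum_congr rfl fun B hB => ?_
  rw [Finset.sum_comm]
  refine Finset.sum_congr rfl fun B' hB' => ?_
  have h := sum_productTensor_mul (B.coord t N) (B'.coord t N)
  have h2 : ∀ i, ∑ j, B.coord t N i j * B'.coord t N i j =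
      max 0 (min (B.b i : ℝ) (B'.b i) - max (B.a i : ℝ) (B'.a i)) := by
    intro i
    obtain ⟨⟨α, hα, hα'⟩, β, hβ, hβ'⟩ := hs.2 B hB i
    obtain ⟨⟨γ, hγ, hγ'⟩, δ, hδ, hδ'⟩ := hs'.2 B' hB' i
    rw [OffDiagonalBox.coord, OffDiagonalBox.coord, ← hα', ← hβ', ← hγ', ← hδ',
      sum_gridCoord_mul hs.1 hβ]
  rw [Finset.prod_congr rfl fun i _ => h2 i] at h
  rw [OffDiagonalBox.inner, ← h, Finset.mul_sum]
  exact Finset.sum_congr rfl fun w _ => by ring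

theorem E_star_simpleIntegral_mul (s s' : OffDiagonalBox q →₀ ℝ) :
    P.E (star (simpleIntegral W s) * simpleIntegral W s') =
      ((s.sum fun B c => s'.sum fun B' c' => c * c' * B.inner B' : ℝ) : ℂ) := by
  obtain ⟨t, N, hs, hs'⟩ := exists_isGridFor s s'
  rw [hs.simpleIntegral_eq W, hs'.simpleIntegral_eq W,
    (W.isSemicircularSystem hs.1 N).map_star_wordSum_mul (W.isSelfAdjoint_gridIncrement t N)
      (simpleKernel_isChain hs.1 s) (simpleKernel_isChain hs.1 s'), sum_simpleKernel_mul hs hs']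

/-- The mirror image of a box. -/
def OffDiagonalBox.mirror (B : OffDiagonalBox q) : OffDiagonalBox q where
  a i := B.a i.rev
  b i := B.b i.rev
  lt i := B.lt i.rev
  disjoint _ _ h := B.disjoint _ _ (Fin.rev_injective.ne h)

@[simp]
theorem OffDiagonalBox.mirror_mirror (B : OffDiagonalBox q) : B.mirror.mirror = B := by
  simp [OffDiagonalBox.mirror]

/-- The mirror image of a simple function. -/
noncomputable def mirrorSimple (s : OffDiagonalBox q →₀ ℝ) : OffDiagonalBox q →₀ ℝ :=
  s.mapDomain OffDiagonalBox.mirror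

theorem simpleKernel_mirrorSimple (s : OffDiagonalBox q →₀ ℝ) (w : List (Fin N)) :
    simpleKernel t N (mirrorSimple s) w = simpleKernel t N s w.reverse := by
  rw [simpleKernel, mirrorSimple, Finsupp.sum_mapDomain_index (by simp) (by intros; ring),
    simpleKernel]
  refine Finset.sum_congr rfl fun B _ => ?_
  dsimp only
  rw [← productTensor_reverse (List.ofFn (B.coord t N)) w.reverse, List.reverse_reverse]
  congr 2
  apply List.ext_getElem
  · simp
  · intro i h1 h2
    rw [List.getElem_reverse, List.getElem_ofFn, List.getElem_ofFn]
    change B.coord t N (Fin.rev _) = _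
    congr 1
    exact Fin.ext (by simp [Fin.rev]; omega)

theorem isMirrorKernel_simpleKernel (hs : IsGridFor t N s) (hm : mirrorSimple s = s) :
    IsMirrorKernel q (simpleKernel t N s) where
  length_eq := simpleKernel_length s
  isChain := simpleKernel_isChain hs.1 s
  reverse w := by rw [← simpleKernel_mirrorSimple, hm]

theorem star_simpleIntegral (hm : mirrorSimple s = s) :
    star (simpleIntegral W s) = simpleIntegral W s := by
  obtain ⟨t, N, hs, -⟩ := exists_isGridFor s s
  rw [hs.simpleIntegral_eq W, star_wordSum (W.isSelfAdjoint_gridIncrement t N)]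
  simp only [(isMirrorKernel_simpleKernel hs hm).reverse]

theorem l2Norm_simpleIntegral_sq (hs : IsGridFor t N s) :
    P.l2Norm (simpleIntegral W s) ^ 2 = normSqOrder q (simpleKernel t N s) := by
  have h := P.E_star_mul_self_eq (simpleIntegral W s)
  rw [hs.simpleIntegral_eq W, (W.isSemicircularSystem hs.1 N).map_star_wordSum_mul
    (W.isSelfAdjoint_gridIncrement t N) (simpleKernel_isChain hs.1 s)
    (simpleKernel_isChain hs.1 s)] at h
  rw [hs.simpleIntegral_eq W, ← Complex.ofReal_inj, ← h, normSqOrder]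
  simp only [sq]

/-- The Haagerup inequality for Wigner integrals of mirror symmetric simple functions. -/
theorem norm_simpleIntegral_le (hm : mirrorSimple s = s) :
    ‖simpleIntegral W s‖ ≤ (q + 1) * P.l2Norm (simpleIntegral W s) := by
  have hsa := star_simpleIntegral W hm
  obtain ⟨t, N, hs, -⟩ := exists_isGridFor s s
  refine P.norm_le_of_moments hsa (mul_nonneg (by positivity) (P.l2Norm_nonneg _)) fun m => ?_
  have h := map_star_pow_mul_pow_wordSum (W.isSemicircularSystem hs.1 N)
    (W.isSelfAdjoint_gridIncrement t N) q (simpleKernel t N s) m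
  rw [← hs.simpleIntegral_eq W, star_pow, hsa, ← pow_add, ← two_mul] at h
  rw [h, Complex.ofReal_re, mul_pow, l2Norm_simpleIntegral_sq W hs]
  exact fockNormSq_pow_le (simpleKernel_isChain hs.1 s) m

end Grid

/-! ### Density of the simple functions vanishing on diagonals -/

section Density

variable {q : ℕ}

/-- The subset of `ℝ^q` underlying a box. -/
def OffDiagonalBox.toSet (B : OffDiagonalBox q) : Set (Fin q → ℝ) :=
  Set.univ.pi fun i => Set.Ioo (B.a i : ℝ) (B.b i)

theorem OffDiagonalBox.measurableSet (B : OffDiagonalBox q) : MeasurableSet B.toSet :=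
  MeasurableSet.univ_pi fun _ => measurableSet_Ioo

theorem OffDiagonalBox.indicator_eq (B : OffDiagonalBox q) :
    B.indicator = B.toSet.indicator fun _ => 1 := by
  classical
  funext t
  by_cases h : t ∈ B.toSet
  · rw [Set.indicator_of_mem h, OffDiagonalBox.indicator]
    exact Finset.prod_eq_one fun i _ => Set.indicator_of_mem (h i (Set.mem_univ i)) _
  · rw [Set.indicator_of_notMem h, OffDiagonalBox.indicator]
    obtain ⟨i, hi⟩ : ∃ i, t i ∉ Set.Ioo (B.a i : ℝ) (B.b i) := by
      by_contra! h'
      exact h fun i _ => h' i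
    exact Finset.prod_eq_zero (Finset.mem_univ i) (Set.indicator_of_notMem hi _)

theorem orthantMeasure_pi_Ioo {a b : Fin q → ℝ} (ha : ∀ i, 0 ≤ a i) :
    orthantMeasure q (Set.univ.pi fun i => Set.Ioo (a i) (b i)) =
      ∏ i, ENNReal.ofReal (b i - a i) := by
  rw [Measure.pi_pi]
  refine Finset.prod_congr rfl fun i _ => ?_
  have h : Set.Ioo (a i) (b i) ⊆ Set.Ici 0 := fun t ht => (ha i).trans ht.1.le
  rw [Measure.restrict_eq_self _ h, Real.volume_Ioo]

theorem OffDiagonalBox.measure_ne_top (B : OffDiagonalBox q) : orthantMeasure q B.toSet ≠ ∞ := by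
  rw [OffDiagonalBox.toSet, orthantMeasure_pi_Ioo fun i => NNReal.coe_nonneg _]
  exact ENNReal.prod_ne_top fun i _ => ENNReal.ofReal_ne_top

theorem OffDiagonalBox.measureReal_inter (B B' : OffDiagonalBox q) :
    (orthantMeasure q).real (B.toSet ∩ B'.toSet) = B.inner B' := by
  rw [OffDiagonalBox.toSet, OffDiagonalBox.toSet, ← Set.pi_inter_distrib]
  simp only [Set.Ioo_inter_Ioo]
  rw [Measure.real, orthantMeasure_pi_Ioo fun i => le_max_of_le_left (NNReal.coe_nonneg _),
    ENNReal.toReal_prod, OffDiagonalBox.inner]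
  refine Finset.prod_congr rfl fun i _ => ?_
  rw [ENNReal.toReal_ofReal', max_comm]

/-- The class in `L²` of a simple function. -/
noncomputable def simpleLp : (OffDiagonalBox q →₀ ℝ) →ₗ[ℝ] Lp ℝ 2 (orthantMeasure q) :=
  Finsupp.linearCombination ℝ fun B => indicatorConstLp 2 B.measurableSet B.measure_ne_top 1

theorem coeFn_simpleLp (s : OffDiagonalBox q →₀ ℝ) :
    simpleLp s =ᵐ[orthantMeasure q] simpleFunction s := by
  induction s using Finsupp.induction_linear with
  | zero =>
    rw [map_zero]
    filter_upwards [Lp.coeFn_zero ℝ 2 (orthantMeasure q)] with t ht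
    rw [ht]
    simp [simpleFunction]
  | add s s' hs hs' =>
    rw [map_add]
    filter_upwards [hs, hs', Lp.coeFn_add (simpleLp s) (simpleLp s')] with t h1 h2 h3
    rw [h3, Pi.add_apply, h1, h2, simpleFunction, simpleFunction, simpleFunction,
      Finsupp.sum_add_index' (by simp) (by intros; ring)]
  | single B c =>
    rw [simpleLp, Finsupp.linearCombination_single]
    filter_upwards [Lp.coeFn_smul c
      (indicatorConstLp 2 B.measurableSet B.measure_ne_top (1 : ℝ) : Lp ℝ 2 (orthantMeasure q)),
      indicatorConstLp_coeFn (p := 2) (hs := B.measurableSet) (hμs := B.measure_ne_top)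
        (c := (1 : ℝ))] with t h1 h2
    rw [h1, Pi.smul_apply, h2, simpleFunction, Finsupp.sum_single_index (by simp),
      B.indicator_eq, smul_eq_mul]

theorem inner_simpleLp (s s' : OffDiagonalBox q →₀ ℝ) :
    inner ℝ (simpleLp s) (simpleLp s') =
      s.sum fun B c => s'.sum fun B' c' => c * c' * B.inner B' := by
  rw [simpleLp, Finsupp.linearCombination_apply, Finsupp.linearCombination_apply, Finsupp.sum_inner]
  refine Finset.sum_congr rfl fun B _ => ?_
  dsimp only
  rw [Finsupp.inner_sum]
  refine Finset.sum_congr rfl fun B' _ => ?_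
  dsimp only
  rw [real_inner_smul_left, real_inner_smul_right,
    L2.real_inner_indicatorConstLp_one_indicatorConstLp_one B.measurableSet B'.measurableSet
      B.measure_ne_top B'.measure_ne_top, OffDiagonalBox.measureReal_inter, mul_assoc]

theorem eLpNorm_simpleFunction_sub (s : OffDiagonalBox q →₀ ℝ) (f : Lp ℝ 2 (orthantMeasure q)) :
    eLpNorm (fun t => simpleFunction s t - f t) 2 (orthantMeasure q) = ‖simpleLp s - f‖ₑ := by
  rw [Lp.enorm_def]
  refine eLpNorm_congr_ae ?_
  filter_upwards [coeFn_simpleLp s, Lp.coeFn_sub (simpleLp s) f] with t h1 h2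
  rw [h2, Pi.sub_apply, h1]

theorem tendsto_eLpNorm_iff {s : ℕ → OffDiagonalBox q →₀ ℝ} {f : Lp ℝ 2 (orthantMeasure q)} :
    Tendsto (fun n => eLpNorm (fun t => simpleFunction (s n) t - f t) 2 (orthantMeasure q))
      atTop (𝓝 0) ↔ Tendsto (fun n => simpleLp (s n)) atTop (𝓝 f) := by
  simp only [eLpNorm_simpleFunction_sub]
  rw [tendsto_iff_edist_tendsto_0]
  simp only [edist_eq_enorm_sub]

/-- A function which integrates to zero over all sub-boxes of a box vanishes on the box. -/
theorem ae_eq_zero_of_forall_box {g : (Fin q → ℝ) → ℝ} (B₀ : OffDiagonalBox q)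
    (hg : IntegrableOn g B₀.toSet (orthantMeasure q))
    (h : ∀ B : OffDiagonalBox q, ∫ t in B.toSet, g t ∂orthantMeasure q = 0) :
    g =ᵐ[(orthantMeasure q).restrict B₀.toSet] 0 := by
  refine Integrable.ae_eq_zero_of_forall_setIntegral_eq_zero hg fun s hs _ => ?_
  rw [Measure.restrict_restrict hs]
  let C : Fin q → Set (Set ℝ) := fun _ => {S | ∃ l u : ℝ, l < u ∧ Set.Ioo l u = S}
  have hC : ∀ i, IsPiSystem (C i) := fun i => isPiSystem_Ioo id id
  have hgen : (MeasurableSpace.pi : MeasurableSpace (Fin q → ℝ)) =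
      MeasurableSpace.generateFrom (Set.univ.pi '' Set.univ.pi C) := by
    rw [← generateFrom_pi_eq]
    · congr 1
      funext i
      refine (BorelSpace.measurable_eq (α := ℝ)).trans (le_antisymm ?_ ?_)
      · rw [Real.borel_eq_generateFrom_Ioo_rat]
        refine MeasurableSpace.generateFrom_mono ?_
        simp only [Set.iUnion_subset_iff, Set.singleton_subset_iff]
        exact fun a b hab => ⟨a, b, Rat.cast_lt.2 hab, rfl⟩
      · refine MeasurableSpace.generateFrom_le ?_
        rintro _ ⟨l, u, -, rfl⟩
        rw [← BorelSpace.measurable_eq (α := ℝ)]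
        exact measurableSet_Ioo
    · refine fun i => ⟨fun n => Set.Ioo (-(n + 1 : ℝ)) (n + 1), fun n => ⟨_, _, ?_, rfl⟩, ?_⟩
      · linarith [n.cast_nonneg (α := ℝ)]
      · refine Set.eq_univ_of_forall fun x => Set.mem_iUnion.2 ?_
        obtain ⟨n, hn⟩ := exists_nat_gt |x|
        exact ⟨n, abs_lt.1 (hn.trans (lt_add_one _))⟩
  have huniv : ∫ t in B₀.toSet, g t ∂orthantMeasure q = 0 := h B₀
  refine MeasurableSpace.induction_on_inter
    (C := fun s _ => ∫ t in s ∩ B₀.toSet, g t ∂orthantMeasure q = 0) hgen (IsPiSystem.pi hC)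
    (by simp) ?_ ?_ ?_ s hs
  · rintro _ ⟨S, hS, rfl⟩
    choose l u hlu hS' using fun i => hS i (Set.mem_univ i)
    have h1 : Set.univ.pi S ∩ B₀.toSet = Set.univ.pi fun i =>
        Set.Ioo (max (l i) (B₀.a i)) (min (u i) (B₀.b i)) := by
      rw [OffDiagonalBox.toSet, ← Set.pi_inter_distrib]
      simp only [← hS', Set.Ioo_inter_Ioo]
    rw [h1]
    by_cases h2 : ∀ i, max (l i) (B₀.a i) < min (u i) (B₀.b i)
    · have h3 : ∀ i, 0 ≤ max (l i) (B₀.a i) := fun i => le_max_of_le_right (NNReal.coe_nonneg _)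
      have h4 : ∀ i, 0 ≤ min (u i) (B₀.b i) := fun i => (h3 i).trans (h2 i).le
      refine h ⟨fun i => ⟨_, h3 i⟩, fun i => ⟨_, h4 i⟩, fun i => h2 i, fun i j hij => ?_⟩
      refine (B₀.disjoint i j hij).mono (Set.Ioo_subset_Ioo ?_ ?_) (Set.Ioo_subset_Ioo ?_ ?_)
      · exact NNReal.coe_le_coe.1 (le_max_right _ _)
      · exact NNReal.coe_le_coe.1 (min_le_right _ _)
      · exact NNReal.coe_le_coe.1 (le_max_right _ _)
      · exact NNReal.coe_le_coe.1 (min_le_right _ _)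
    · push Not at h2
      obtain ⟨i, hi⟩ := h2
      have h3 : (Set.univ.pi fun i => Set.Ioo (max (l i) (B₀.a i : ℝ)) (min (u i) (B₀.b i))) = ∅ :=
        Set.univ_pi_eq_empty (Set.Ioo_eq_empty_of_le hi)
      rw [h3, setIntegral_empty]
  · intro t ht h0
    have h1 : tᶜ ∩ B₀.toSet = B₀.toSet \ (t ∩ B₀.toSet) := by
      ext x
      simp only [Set.mem_inter_iff, Set.mem_compl_iff, Set.mem_sdiff]
      tauto
    rw [h1, setIntegral_sdiff (ht.inter B₀.measurableSet) hg Set.inter_subset_right, h0, huniv,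
      sub_zero]
  · intro f hf hfm h0
    rw [Set.iUnion_inter, integral_iUnion (fun i => (hfm i).inter B₀.measurableSet)
      (fun i j hij => (hf hij).mono Set.inter_subset_left Set.inter_subset_left)
      (hg.mono_set (Set.iUnion_subset fun i => Set.inter_subset_right))]
    simp [h0]

/-- Points off the diagonals are contained in boxes. -/
theorem exists_box_mem_nhds {x : Fin q → ℝ} (h0 : ∀ i, 0 < x i)
    (hx : ∀ i j, i ≠ j → x i ≠ x j) : ∃ B : OffDiagonalBox q, B.toSet ∈ 𝓝 x := by
  have h1 : ∀ᶠ ε : ℝ in 𝓝[>] 0, ∀ i, ε < x i :=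
    eventually_all.2 fun i => eventually_nhdsWithin_of_eventually_nhds (eventually_lt_nhds (h0 i))
  have h2 : ∀ᶠ ε : ℝ in 𝓝[>] 0, ∀ i j, i ≠ j → ε < |x i - x j| / 2 :=
    eventually_all.2 fun i => eventually_all.2 fun j => by
      by_cases hij : i = j
      · simp [hij]
      · have : 0 < |x i - x j| / 2 := half_pos (abs_pos.2 (sub_ne_zero.2 (hx i j hij)))
        filter_upwards [eventually_nhdsWithin_of_eventually_nhds (eventually_lt_nhds this)]
          with ε hε _ using hε
  obtain ⟨ε, ⟨h3, h4⟩, h5⟩ := ((h1.and h2).and self_mem_nhdsWithin).exists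
  refine ⟨⟨fun i => ⟨x i - ε, (sub_pos.2 (h3 i)).le⟩, fun i => ⟨x i + ε, ?_⟩, fun i => ?_,
    fun i j hij => ?_⟩, ?_⟩
  · exact (add_pos (h0 i) h5).le
  · refine NNReal.coe_lt_coe.1 ?_
    change x i - ε < x i + ε
    linarith
  · refine Set.disjoint_left.2 fun m hm hm' => ?_
    have hm1 : x i - ε < m := hm.1
    have hm2 : (m : ℝ) < x i + ε := hm.2
    have hm3 : x j - ε < m := hm'.1
    have hm4 : (m : ℝ) < x j + ε := hm'.2
    have h6 := h4 i j hij
    have h7 : |x i - x j| < 2 * ε := abs_lt.2 ⟨by linarith, by linarith⟩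
    linarith
  · refine (isOpen_set_pi Set.finite_univ fun i _ => isOpen_Ioo).mem_nhds fun i _ => ?_
    exact ⟨sub_lt_self _ h5, lt_add_of_pos_right _ h5⟩

theorem ae_orthantMeasure_pos : ∀ᵐ t ∂orthantMeasure q, ∀ i, 0 < t i := by
  refine ae_all_iff.2 fun i => ?_
  have h : ∀ᵐ x ∂(volume : Measure ℝ).restrict (Set.Ici 0), 0 < x := by
    rw [← restrict_Ioi_eq_restrict_Ici]
    exact ae_restrict_mem measurableSet_Ioi
  exact (Measure.tendsto_eval_ae_ae (μ := fun _ : Fin q => volume.restrict (Set.Ici (0 : ℝ)))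
    (i := i)).eventually h

theorem ae_orthantMeasure_ne : ∀ᵐ t ∂orthantMeasure q, ∀ i j, i ≠ j → t i ≠ t j := by
  have h : orthantMeasure q ≪ volume := by
    rw [orthantMeasure, ← Measure.restrict_pi_pi, ← volume_pi]
    exact Measure.absolutelyContinuous_of_le Measure.restrict_le_self
  refine h.ae_le (ae_all_iff.2 fun i => ae_all_iff.2 fun j => ?_)
  by_cases hij : i = j
  · simp [hij]
  have h1 := Measure.addHaar_submodule (volume : Measure (Fin q → ℝ))
    (LinearMap.ker (LinearMap.proj (R := ℝ) (φ := fun _ : Fin q => ℝ) i - LinearMap.proj j)) (by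
      intro h2
      have h3 : Pi.single i (1 : ℝ) ∈ LinearMap.ker
          (LinearMap.proj (R := ℝ) (φ := fun _ : Fin q => ℝ) i - LinearMap.proj j) := by
        rw [h2]
        trivial
      simp [Ne.symm hij] at h3)
  filter_upwards [measure_eq_zero_iff_ae_notMem.1 h1] with t ht _ h2
  exact ht (by simp [h2])

theorem range_simpleLp_topologicalClosure :
    (LinearMap.range (simpleLp (q := q))).topologicalClosure = ⊤ := by
  rw [Submodule.topologicalClosure_eq_top_iff, Submodule.eq_bot_iff]
  intro g hg
  have h1 : ∀ B : OffDiagonalBox q, ∫ t in B.toSet, g t ∂orthantMeasure q = 0 := by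
    intro B
    have h2 := (Submodule.mem_orthogonal _ _).1 hg (simpleLp (Finsupp.single B 1))
      (LinearMap.mem_range_self _ _)
    rw [simpleLp, Finsupp.linearCombination_single, one_smul, L2.inner_indicatorConstLp_one] at h2
    exact h2
  have h2 : ∀ B : OffDiagonalBox q, orthantMeasure q ({t | g t ≠ 0} ∩ B.toSet) = 0 := by
    intro B
    have h3 : IntegrableOn g B.toSet (orthantMeasure q) := by
      have : IsFiniteMeasure ((orthantMeasure q).restrict B.toSet) :=
        isFiniteMeasure_restrict.2 B.measure_ne_top
      exact ((Lp.memLp g).restrict _).integrable one_le_two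
    have h4 := ae_eq_zero_of_forall_box B h3 h1
    rw [Filter.EventuallyEq, ae_iff, Measure.restrict_apply' B.measurableSet] at h4
    exact h4
  have h3 : orthantMeasure q ({t | g t ≠ 0} ∩ {t | (∀ i, 0 < t i) ∧ ∀ i j, i ≠ j → t i ≠ t j}) =
      0 := by
    refine measure_null_of_locally_null _ fun x hx => ?_
    obtain ⟨B, hB⟩ := exists_box_mem_nhds hx.2.1 hx.2.2
    refine ⟨_, inter_mem_nhdsWithin _ hB, measure_mono_null ?_ (h2 B)⟩
    exact Set.inter_subset_inter_left _ Set.inter_subset_left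
  refine (Lp.eq_zero_iff_ae_eq_zero).2 ?_
  filter_upwards [ae_orthantMeasure_pos, ae_orthantMeasure_ne, measure_eq_zero_iff_ae_notMem.1 h3]
    with t h4 h5 h6
  by_contra h7
  exact h6 ⟨h7, h4, h5⟩

theorem exists_tendsto_simpleLp (f : Lp ℝ 2 (orthantMeasure q)) :
    ∃ s : ℕ → OffDiagonalBox q →₀ ℝ, Tendsto (fun n => simpleLp (s n)) atTop (𝓝 f) := by
  have h : f ∈ closure (LinearMap.range (simpleLp (q := q)) : Set _) := by
    rw [← Submodule.topologicalClosure_coe, range_simpleLp_topologicalClosure]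
    trivial
  obtain ⟨x, hx, hxf⟩ := mem_closure_iff_seq_limit.1 h
  choose s hs using hx
  exact ⟨s, by simpa only [hs] using hxf⟩

/-! ### Mirror symmetry -/

theorem mirrorSimple_add (s s' : OffDiagonalBox q →₀ ℝ) :
    mirrorSimple (s + s') = mirrorSimple s + mirrorSimple s' :=
  Finsupp.mapDomain_add

theorem mirrorSimple_smul (c : ℝ) (s : OffDiagonalBox q →₀ ℝ) :
    mirrorSimple (c • s) = c • mirrorSimple s :=
  Finsupp.mapDomain_smul c s

theorem mirrorSimple_mirrorSimple (s : OffDiagonalBox q →₀ ℝ) :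
    mirrorSimple (mirrorSimple s) = s := by
  rw [mirrorSimple, mirrorSimple, ← Finsupp.mapDomain_comp]
  convert Finsupp.mapDomain_id
  funext B
  exact B.mirror_mirror

theorem simpleFunction_mirrorSimple (s : OffDiagonalBox q →₀ ℝ) (t : Fin q → ℝ) :
    simpleFunction (mirrorSimple s) t = simpleFunction s fun i => t i.rev := by
  rw [simpleFunction, mirrorSimple, Finsupp.sum_mapDomain_index (by simp) (by intros; ring),
    simpleFunction]
  refine Finset.sum_congr rfl fun B _ => ?_
  dsimp only
  congr 1
  rw [OffDiagonalBox.indicator, OffDiagonalBox.indicator, ← Equiv.prod_comp Fin.revPerm]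
  simp [OffDiagonalBox.mirror]

theorem measurePreserving_mirror :
    MeasurePreserving (fun (t : Fin q → ℝ) i => t i.rev) (orthantMeasure q) (orthantMeasure q) := by
  have h := measurePreserving_piCongrLeft
    (fun _ : Fin q => (volume : Measure ℝ).restrict (Set.Ici 0)) Fin.revPerm
  convert h using 1
  funext t i
  rw [MeasurableEquiv.coe_piCongrLeft]
  conv_rhs => rw [← Fin.rev_rev i]
  exact (Equiv.piCongrLeft_apply_apply (fun _ : Fin q => ℝ) Fin.revPerm t i.rev).symm

theorem exists_mirror_tendsto_simpleLp {f : Lp ℝ 2 (orthantMeasure q)}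
    (hf : ∀ᵐ t ∂orthantMeasure q, f (fun i => t i.rev) = f t) :
    ∃ s : ℕ → OffDiagonalBox q →₀ ℝ, (∀ n, mirrorSimple (s n) = s n) ∧
      Tendsto (fun n => simpleLp (s n)) atTop (𝓝 f) := by
  obtain ⟨s, hs⟩ := exists_tendsto_simpleLp f
  have hs' : Tendsto (fun n => simpleLp (mirrorSimple (s n))) atTop (𝓝 f) := by
    rw [← tendsto_eLpNorm_iff] at hs ⊢
    refine hs.congr fun n => ?_
    rw [← eLpNorm_comp_measurePreserving _ measurePreserving_mirror]
    · refine eLpNorm_congr_ae ?_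
      filter_upwards [hf] with t ht
      rw [Function.comp_apply, simpleFunction_mirrorSimple, ht]
    · exact ((Lp.aestronglyMeasurable _).congr (coeFn_simpleLp (s n))).sub
        (Lp.aestronglyMeasurable f)
  refine ⟨fun n => (1 / 2 : ℝ) • (s n + mirrorSimple (s n)), fun n => ?_, ?_⟩
  · rw [mirrorSimple_smul, mirrorSimple_add, mirrorSimple_mirrorSimple, add_comm]
  · have h := (hs.add hs').const_smul (1 / 2 : ℝ)
    rw [← two_smul ℝ f, smul_smul] at h
    simpa using h

end Density

/-! ### The Wigner integral -/

section WignerIntegral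

variable {H : Type*} [NormedAddCommGroup H] [InnerProductSpace ℂ H] [CompleteSpace H]
  {P : WStarProbabilitySpace H} (W : FreeBrownianMotion P) {q : ℕ}

theorem simpleIntegral_sub (s s' : OffDiagonalBox q →₀ ℝ) :
    simpleIntegral W (s - s') = simpleIntegral W s - simpleIntegral W s' :=
  Finsupp.sum_sub_index fun _ _ _ => by rw [Complex.ofReal_sub, sub_smul]

/-- The Wigner isometry. -/
theorem l2Norm_simpleIntegral (s : OffDiagonalBox q →₀ ℝ) :
    P.l2Norm (simpleIntegral W s) = ‖simpleLp s‖ := by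
  have h := P.E_star_mul_self_eq (simpleIntegral W s)
  rw [E_star_simpleIntegral_mul, ← inner_simpleLp, real_inner_self_eq_norm_sq,
    Complex.ofReal_inj] at h
  exact ((pow_left_inj₀ (norm_nonneg _) (P.l2Norm_nonneg _) two_ne_zero).1 h).symm

theorem exists_tendsto_simpleIntegral {s : ℕ → OffDiagonalBox q →₀ ℝ}
    (hm : ∀ n, mirrorSimple (s n) = s n) {f : Lp ℝ 2 (orthantMeasure q)}
    (hs : Tendsto (fun n => simpleLp (s n)) atTop (𝓝 f)) :
    ∃ X : P.Elem, Tendsto (fun n => simpleIntegral W (s n)) atTop (𝓝 X) := by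
  have : CompleteSpace P.Elem := P.isClosed_algebra.completeSpace_coe
  refine cauchySeq_tendsto_of_complete (Metric.cauchySeq_iff.2 fun ε hε => ?_)
  have hq : (0 : ℝ) < q + 1 := by positivity
  obtain ⟨N, hN⟩ := Metric.cauchySeq_iff.1 hs.cauchySeq (ε / (q + 1)) (div_pos hε hq)
  refine ⟨N, fun n hn m hm' => ?_⟩
  have h1 : mirrorSimple (s n - s m) = s n - s m := by
    rw [sub_eq_add_neg, ← neg_one_smul ℝ, mirrorSimple_add, mirrorSimple_smul, hm, hm]
  have h2 := norm_simpleIntegral_le W h1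
  have h3 := hN n hn m hm'
  rw [l2Norm_simpleIntegral, map_sub, simpleIntegral_sub, ← dist_eq_norm, ← dist_eq_norm] at h2
  rw [lt_div_iff₀' hq] at h3
  exact h2.trans_lt h3

theorem isWignerIntegral_of_tendsto {s : ℕ → OffDiagonalBox q →₀ ℝ}
    {f : Lp ℝ 2 (orthantMeasure q)} (hs : Tendsto (fun n => simpleLp (s n)) atTop (𝓝 f))
    {X : P.Elem} (hX : Tendsto (fun n => simpleIntegral W (s n)) atTop (𝓝 X)) :
    IsWignerIntegral W f X :=
  ⟨s, tendsto_eLpNorm_iff.2 hs, P.tendsto_l2Norm_sub hX⟩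

variable {W}

theorem IsWignerIntegral.unique {f : Lp ℝ 2 (orthantMeasure q)} {X Y : P.Elem}
    (hX : IsWignerIntegral W f X) (hY : IsWignerIntegral W f Y) : X = Y := by
  obtain ⟨s, hs, hsX⟩ := hX
  obtain ⟨s', hs', hsY⟩ := hY
  rw [tendsto_eLpNorm_iff] at hs hs'
  have h1 : ∀ n, P.l2Norm (X - Y) ^ 2 ≤ 2 * P.l2Norm (simpleIntegral W (s n) - X) ^ 2 +
      2 * (2 * ‖simpleLp (s n) - simpleLp (s' n)‖ ^ 2 +
        2 * P.l2Norm (simpleIntegral W (s' n) - Y) ^ 2) := by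
    intro n
    have h2 := P.l2Norm_sq_add_le (-(simpleIntegral W (s n) - X)) (simpleIntegral W (s n) - Y)
    have h3 := P.l2Norm_sq_add_le (simpleIntegral W (s n) - simpleIntegral W (s' n))
      (simpleIntegral W (s' n) - Y)
    have h4 : ∀ a : P.Elem, P.l2Norm (-a) = P.l2Norm a := fun a => by
      rw [WStarProbabilitySpace.l2Norm, star_neg, neg_mul_neg, WStarProbabilitySpace.l2Norm]
    rw [h4, neg_sub, sub_add_sub_cancel] at h2
    rw [sub_add_sub_cancel, ← simpleIntegral_sub, l2Norm_simpleIntegral, map_sub] at h3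
    linarith
  have h2 : Tendsto (fun n => 2 * P.l2Norm (simpleIntegral W (s n) - X) ^ 2 +
      2 * (2 * ‖simpleLp (s n) - simpleLp (s' n)‖ ^ 2 +
        2 * P.l2Norm (simpleIntegral W (s' n) - Y) ^ 2)) atTop
      (𝓝 (2 * 0 ^ 2 + 2 * (2 * ‖f - f‖ ^ 2 + 2 * 0 ^ 2))) :=
    ((hsX.pow 2).const_mul 2).add ((((hs.sub hs').norm.pow 2).const_mul 2).add
      ((hsY.pow 2).const_mul 2) |>.const_mul 2)
  have h3 := ge_of_tendsto' h2 h1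
  rw [sub_self, norm_zero] at h3
  have h4 : P.l2Norm (X - Y) ^ 2 = 0 := le_antisymm (by linarith) (sq_nonneg _)
  exact sub_eq_zero.1 (P.eq_zero_of_l2Norm (pow_eq_zero_iff two_ne_zero |>.1 h4))

theorem WStarProbabilitySpace.E_pow_two_mul {x : P.Elem} (hx : star x = x) (m : ℕ) :
    P.E (x ^ (2 * m)) = ((P.E (x ^ (2 * m))).re : ℂ) := by
  have h := P.E_star_mul_self_eq (x ^ m)
  rw [star_pow, hx, ← pow_add, ← two_mul] at h
  rw [h, Complex.ofReal_re]

theorem exists_eq_cons_append_singleton {α : Type*} {p : ℕ} {l : List α}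
    (h : l.length = 1 + (p + 1)) : ∃ a m c, l = [a] ++ (m ++ [c]) ∧ m.length = p := by
  obtain ⟨a, l, rfl⟩ := List.exists_cons_of_length_eq_add_one (h.trans (add_comm 1 (p + 1)))
  have h' : l.length = p + 1 := by simp at h; omega
  have hne : l ≠ [] := List.ne_nil_of_length_eq_add_one h'
  exact ⟨a, l.dropLast, l.getLast hne, by rw [List.dropLast_append_getLast]; rfl, by simp [h']⟩

variable (W)

/-- The sixth moment of the integral of a mirror symmetric simple function controls its inner
products with the indicators of boxes. -/
theorem inner_pow_six_le (hq : 3 ≤ q) {s : OffDiagonalBox q →₀ ℝ} (hm : mirrorSimple s = s)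
    (B : OffDiagonalBox q) {m₂ m₄ m₆ : ℝ} (h₂ : P.E (simpleIntegral W s ^ 2) = m₂)
    (h₄ : P.E (simpleIntegral W s ^ 4) = m₄) (h₆ : P.E (simpleIntegral W s ^ 6) = m₆) :
    m₂ * inner ℝ (simpleLp s) (simpleLp (Finsupp.single B 1)) ^ 6 ≤
      (‖simpleLp (Finsupp.single B 1)‖ ^ 2) ^ 3 *
        (m₂ * m₆ - (m₂ ^ 4 + m₄ ^ 2 + 2 * m₂ ^ 2 * (m₄ - 2 * m₂ ^ 2))) := by
  obtain ⟨p, rfl⟩ : ∃ p, q = 1 + (p + 1) := ⟨q - 2, by omega⟩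
  obtain ⟨t, N, hs, hB⟩ := exists_isGridFor s (Finsupp.single B 1)
  have hsys := W.isSemicircularSystem hs.1 N
  have hsa := W.isSelfAdjoint_gridIncrement t N
  have hf := isMirrorKernel_simpleKernel hs hm
  have hm₂ : 0 ≤ m₂ := by
    have h := P.E_star_mul_self_nonneg (simpleIntegral W s)
    rw [star_simpleIntegral W hm, ← sq, h₂] at h
    exact_mod_cast h
  rw [hs.simpleIntegral_eq W] at h₂ h₄ h₆
  have h1 := hf.sixth_moment_bound hq hsys hsa h₂ h₄ h₆
  obtain ⟨g, gs, g', hg, hlen⟩ := exists_eq_cons_append_singleton (List.length_ofFn (f := B.coord t N))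
  have hker : simpleKernel t N (Finsupp.single B 1) = productTensor (List.ofFn (B.coord t N)) := by
    funext w
    rw [simpleKernel, Finsupp.sum_single_index (by simp), one_mul]
  have h2 := sum_mul_pow_six_le (p := p) (b := simpleKernel t N (Finsupp.single B 1)) hf.reverse
    (g := productTensor [g]) (η := productTensor gs) (h := productTensor [g']) (by
      intro u hu y hy v hv
      rw [mem_words] at hu hy hv
      rw [hker, hg, productTensor_append _ _ _ _ (by simpa using hu),
        productTensor_append _ _ _ _ (by omega), mul_assoc])
  rw [sum_simpleKernel_mul hs hB, ← inner_simpleLp, ← l2Norm_simpleIntegral_sq W hB,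
    l2Norm_simpleIntegral] at h2
  have h3 : 3 * (1 + (p + 1)) - 4 = 1 + (p + (p + (p + 1))) := by omega
  rw [h3] at h1
  calc _ ≤ m₂ * _ := mul_le_mul_of_nonneg_left h2 hm₂
    _ = (‖simpleLp (Finsupp.single B 1)‖ ^ 2) ^ 3 * (m₂ * _) := mul_left_comm _ _ _
    _ ≤ _ := mul_le_mul_of_nonneg_left (by linarith) (by positivity)

theorem eq_zero_of_moments (hq : 3 ≤ q) {s : ℕ → OffDiagonalBox q →₀ ℝ}
    (hm : ∀ n, mirrorSimple (s n) = s n) {f : Lp ℝ 2 (orthantMeasure q)}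
    (hs : Tendsto (fun n => simpleLp (s n)) atTop (𝓝 f)) {X : P.Elem}
    (hX : Tendsto (fun n => simpleIntegral W (s n)) atTop (𝓝 X)) (h₂ : P.E (X ^ 2) = 1)
    (h₄ : P.E (X ^ 4) = 5 / 2) (h₆ : P.E (X ^ 6) = 33 / 4) : f = 0 := by
  have hE : ∀ k, Tendsto (fun n => (P.E (simpleIntegral W (s n) ^ k)).re) atTop
      (𝓝 (P.E (X ^ k)).re) := fun k =>
    (Complex.continuous_re.tendsto _).comp (P.tendsto_E (hX.pow k))
  have h2 := hE 2
  have h4 := hE 4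
  have h6 := hE 6
  rw [h₂, Complex.one_re] at h2
  rw [h₄, show (5 / 2 : ℂ) = ((5 / 2 : ℝ) : ℂ) by norm_num, Complex.ofReal_re] at h4
  rw [h₆, show (33 / 4 : ℂ) = ((33 / 4 : ℝ) : ℂ) by norm_num, Complex.ofReal_re] at h6
  have hB : ∀ B : OffDiagonalBox q, inner ℝ (simpleLp (Finsupp.single B 1)) f = 0 := by
    intro B
    have h := le_of_tendsto_of_tendsto' (h2.mul ((hs.inner tendsto_const_nhds).pow 6))
      (((h2.mul h6).sub (((h2.pow 4).add (h4.pow 2)).add (((h2.pow 2).const_mul 2).mul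
        (h4.sub ((h2.pow 2).const_mul 2))))).const_mul _)
      fun n => inner_pow_six_le W hq (hm n) B
        (P.E_pow_two_mul (star_simpleIntegral W (hm n)) 1)
        (P.E_pow_two_mul (star_simpleIntegral W (hm n)) 2)
        (P.E_pow_two_mul (star_simpleIntegral W (hm n)) 3)
    norm_num at h
    rw [real_inner_comm]
    exact pow_eq_zero_iff (by norm_num) |>.1 (le_antisymm h (Even.pow_nonneg ⟨3, rfl⟩ _))
  have hf : f ∈ (LinearMap.range (simpleLp (q := q)))ᗮ := by
    rw [Submodule.mem_orthogonal]
    rintro _ ⟨s', rfl⟩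
    induction s' using Finsupp.induction_linear with
    | zero => rw [map_zero, inner_zero_left]
    | add s₁ s₂ h₁ h₂ => rw [map_add, inner_add_left, h₁, h₂, add_zero]
    | single B c =>
      rw [← mul_one c, ← smul_eq_mul, ← Finsupp.smul_single, map_smul, real_inner_smul_left, hB,
        mul_zero]
  rwa [Submodule.topologicalClosure_eq_top_iff.1 range_simpleLp_topologicalClosure,
    Submodule.mem_bot] at hf

end WignerIntegral

theorem corollary1p2 {H : Type u} [NormedAddCommGroup H] [InnerProductSpace ℂ H]
    [CompleteSpace H] (P : WStarProbabilitySpace H) (W : FreeBrownianMotion P)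
    (q : ℕ) (hq : 3 ≤ q) (f : Lp ℝ 2 (orthantMeasure q)) (hf : ‖f‖ = 1)
    (hmirror : ∀ᵐ t ∂(orthantMeasure q), f (fun i => t i.rev) = f t) :
    (∃! X : P.Elem, IsWignerIntegral W f X) ∧
      ∀ X : P.Elem, IsWignerIntegral W f X →
        IsSelfAdjoint X ∧ ¬ ∃ μ : Measure ℝ, IsTetillaLaw.{v} μ ∧ IsLaw P.E X μ := by
  obtain ⟨s, hm, hs⟩ := exists_mirror_tendsto_simpleLp hmirror
  obtain ⟨X, hX⟩ := exists_tendsto_simpleIntegral W hm hs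
  have hXf := isWignerIntegral_of_tendsto W hs hX
  refine ⟨⟨X, hXf, fun Y hY => hY.unique hXf⟩, fun Y hY => ?_⟩
  obtain rfl := hY.unique hXf
  refine ⟨tendsto_nhds_unique (hX.star.congr fun n => star_simpleIntegral W (hm n)) hX, ?_⟩
  rintro ⟨μ, ⟨K, _, _, _, Q, x, y, hx, hy, hlx, hly, hfree, hT⟩, hμ⟩
  obtain ⟨h₂, h₄, h₆⟩ := tetilla_moments Q.map_one hx hy hlx hly hfree
  have hE : ∀ k, P.E (Y ^ k) = Q.E ((((√2 : ℝ) : ℂ)⁻¹ • (x * y + y * x)) ^ k) := fun k => by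
    rw [(hμ.2 k).2, (hT.2 k).2]
  have h0 := eq_zero_of_moments W hq hm hs hX ((hE 2).trans h₂) ((hE 4).trans h₄)
    ((hE 6).trans h₆)
  rw [h0, norm_zero] at hf
  exact zero_ne_one hf
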